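/- **Setting.** For $n\ge 0$ and vectors $v_1,\dots,v_d\in\mathbb R^n$ let $\mathfrak c(v_1,\dots,v_d)$ be the convex cone they generate. A polyhedral cone is a finitely generated convex cone, and it *contains lines* if it contains $u$ and $-u$ for some $u\ne 0$. Write $[C]$ for the indicator function of $C$. For a polyhedral cone $C\subseteq\mathbb R^n$, $n\ge1$, the normalized solid angle is $$\tilde\Omega_n(C)=\frac{\mathrm{vol}_{n-1}(C\cap S_{n-1})}{\mathrm{vol}_{n-1}(S_{n-1})},$$ and $\tilde\Omega_0(\{0\})=1$. For linearly independent unit vectors $v_1,\dots,v_n\in\mathbb R^n$ let $M(v)$ be the $n\times n$ matrix with diagonal entries $1$ and entries $-|v_i\cdot v_j|$ for $i\ne j$, let $V$ be the matrix with columns $v_i$, put $\alpha_{ij}=v_i\cdot v_j$, and let $$T(v)=\frac{|\det V|}{(4\pi)^{n/2}}\sum_{a\in\mathbb N^{\binom n2}}\left[\frac{(-2)^{\sum_{i<j}a_{ij}}}{\prod_{i<j}a_{ij}!}\prod_{i=1}^n\Gamma\!\left(\frac{1+\sum_{m\ne i}a_{im}}2\right)\right]\prod_{i<j}\alpha_{ij}^{a_{ij}}\qquad(a_{ij}=a_{ji}).$$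 Let $w_1,\dots,w_n\in\mathbb R^n$ be linearly independent unit vectors. A *first decomposition* of $C=\mathfrak c(w_1,\dots,w_n)$ consists of finitely many polyhedral cones $C_1,\dots,C_N\subseteq\mathbb R^n$ and signs $s_i\in\{\pm1\}$ with $[C]=\sum_{i=1}^N s_i[C_i]$ everywhere, such that each $C_i$ is either * (I) a cone containing lines, or * (II) a cone $\mathfrak c(v_1,\dots,v_n)$ with $v_1,\dots,v_n$ linearly independent, $M(v)$ positive definite, and (a) $\|v_j\|=1$ for all $j$; (b) $v_n=w_n$; (c) $\langle v_1,\dots,v_{n-1}\rangle=\langle w_1,\dots,w_{n-1}\rangle$; (d) $v_j\cdot v_n=0$ for $1\le j\le n-2$; (e) for some $\epsilon_1,\dots,\epsilon_n\in\{\pm1\}$, $x^TM(v)x=\big\|\sum_j\epsilon_jx_jv_j\big\|^2$ for all $x\in\mathbb R^n$. (For $n=0$, (b)–(d) are void.) For $m\le n$, a linear isometric embedding $\varphi:\mathbb R^m\to\mathbb R^n$ and a convex cone $C'\subseteq\mathbb R^m$ (containing $0$) let $C'\oplus_\varphi L=\varphi(C')+\varphi(\mathbb R^m)^\perp$ be the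 orthogonal sum of a copy of $C'$ and the linear subspace $L=\varphi(\mathbb R^m)^\perp$. The relation "*the pair $(K,t)$ is computed in dimension $n$*" ($K\subseteq\mathbb R^n$ a cone, $t\in\mathbb R$) is the smallest one such that: * if $v_1,\dots,v_n\in\mathbb R^n$ are linearly independent unit vectors, $M(v)$ is positive definite and the series in $T(v)$ converges absolutely, then $(\mathfrak c(v_1,\dots,v_n),T(v))$ is computed in dimension $n$; * if $m<n$ and $(C',t)$ is computed in dimension $m$, then $(C'\oplus_\varphi L,t)$ is computed in dimension $n$ for every $\varphi$ as above; * if $(C_i,s_i)_{i\le N}$ is a first decomposition of $\mathfrak c(v_1,\dots,v_n)$, where $v_1,\dots,v_n$ are linearly independent unit vectors, and each $(C_i,t_i)$ is computed in dimension $n$, then $(\mathfrak c(v_1,\dots,v_n),\sum_i s_it_i)$ is computed in dimension $n$. **Corollary 2.4.** Let $w_1,\dots,w_n\in\mathbb R^n$ be linearly independent unit vectors and $C=\mathfrak c(w_1,\dots,w_n)$. 1. There is a first decomposition $(C_i,s_i)_{i\le N}$ of $C$ such that $(C_i,\tilde\Omega_n(C_i))$ is computed in dimension $n$ for every $i$.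 2. For every first decomposition $(C_i,s_i)_{i\le N}$ of $C$: * $\tilde\Omega_n(C)=\sum_{i=1}^N s_i\,\tilde\Omega_n(C_i)$; * if $C_i=\mathfrak c(v_1,\dots,v_n)$ with $v$ as in (II), then the series in $T(v)$ converges absolutely and $\tilde\Omega_n(C_i)=T(v)$; * if $C_i$ contains lines, then $C_i=C'\oplus_\varphi L$ for some $m<n$, some $\varphi$ and some polyhedral cone $C'\subseteq\mathbb R^m$; and whenever $C_i=C'\oplus_\varphi L$ with a cone $C'\subseteq\mathbb R^m$, then $\tilde\Omega_n(C_i)=\tilde\Omega_m(C')$; * if $(C_i,t)$ is computed in dimension $n$, then $t=\tilde\Omega_n(C_i)$. 3. For $t\in\mathbb R$, the pair $(C,t)$ is computed in dimension $n$ if and only if $t=\tilde\Omega_n(C)$. -/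

import Mathlib

open MeasureTheory
open scoped BigOperators Matrix

noncomputable section

/-- Euclidean space `ℝⁿ`. -/
abbrev Euc (n : ℕ) : Type := EuclideanSpace ℝ (Fin n)

/-- The cone `𝔠(v₁, …, v_d)` generated by finitely many vectors of `ℝⁿ`. -/
def genCone {n d : ℕ} (v : Fin d → Euc n) : PointedCone ℝ (Euc n) :=
  PointedCone.hull ℝ (Set.range v)

/-- The normalized solid angle measure of a subset `C` of `ℝⁿ` (with respect to `ℝⁿ`): the surface
measure of the part of the unit sphere that lies in `C`, divided by the surface measure of the whole
sphere. In `ℝ⁰`, where the unit sphere is empty, the normalization "the whole space has measure 1"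
is used for the only cone `{0}`. -/
def solidAngle {n : ℕ} (C : Set (Euc n)) : ℝ :=
  if n = 0 then 1
  else ((volume : Measure (Euc n)).toSphere
          ((Subtype.val : Metric.sphere (0 : Euc n) 1 → Euc n) ⁻¹' C)).toReal /
       ((volume : Measure (Euc n)).toSphere Set.univ).toReal

/-- The associated matrix of the generators `v₁, …, vₙ`: `1` on the diagonal and `-|vᵢ · vⱼ|` off the
diagonal. -/
def assocMatrix {n : ℕ} (v : Fin n → Euc n) : Matrix (Fin n) (Fin n) ℝ :=
  Matrix.of fun i j => if i = j then 1 else -|inner ℝ (v i) (v j)|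

/-- The index pairs `i < j`. -/
abbrev IndexPair (n : ℕ) : Type := {p : Fin n × Fin n // p.1 < p.2}

/-- The term of multiexponent `a` of the series: with `αᵢⱼ = vᵢ · vⱼ`,
`(-2)^(∑ aᵢⱼ) / ∏ aᵢⱼ! * ∏ᵢ Γ((1 + ∑_{m ≠ i} aᵢₘ) / 2) * ∏ αᵢⱼ ^ aᵢⱼ`. The sum `∑_{m ≠ i} aᵢₘ` runs
over the pairs in which `i` is the first or the second index. -/
def seriesTerm {n : ℕ} (v : Fin n → Euc n) (a : IndexPair n → ℕ) : ℝ :=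
  (-2 : ℝ) ^ (∑ p, a p) / (∏ p, ((a p).factorial : ℝ)) *
    (∏ i : Fin n,
      Real.Gamma ((1 + ∑ p : IndexPair n, if p.1.1 = i ∨ p.1.2 = i then (a p : ℝ) else 0) / 2)) *
    ∏ p : IndexPair n, (inner ℝ (v p.1.1) (v p.1.2)) ^ (a p)

/-- The power series `T_α = |det V| / (4π)^(n/2) * ∑_a (…)`, where `V` has columns `v₁, …, vₙ`.
It is only used together with the absolute convergence `Summable fun a => ‖seriesTerm v a‖`. -/
def seriesValue {n : ℕ} (v : Fin n → Euc n) : ℝ :=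
  |(Matrix.of fun i j => v j i : Matrix (Fin n) (Fin n) ℝ).det| / (4 * Real.pi) ^ ((n : ℝ) / 2) *
    ∑' a : IndexPair n → ℕ, seriesTerm v a

/-- Pieces of the first kind: polyhedral (that is, finitely generated) cones containing lines. -/
def IsConeWithLine {n : ℕ} (C : PointedCone ℝ (Euc n)) : Prop :=
  C.FG ∧ ∃ u : Euc n, u ≠ 0 ∧ u ∈ C ∧ -u ∈ C

/-- Generators `v₁, …, vₙ` of a piece of the second kind in the decomposition of the cone
generated by `w₁, …, wₙ`. -/
structure IsDefiniteForm {n : ℕ} (w v : Fin n → Euc n) : Prop where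
  linearIndependent : LinearIndependent ℝ v
  posDef : (assocMatrix v).PosDef
  norm_eq_one : ∀ i, ‖v i‖ = 1
  /-- `vₙ = wₙ` -/
  last_eq : ∀ i : Fin n, (i : ℕ) + 1 = n → v i = w i
  /-- `⟨v₁, …, vₙ₋₁⟩ = ⟨w₁, …, wₙ₋₁⟩` -/
  span_eq : Submodule.span ℝ (v '' {i | (i : ℕ) + 1 < n}) =
    Submodule.span ℝ (w '' {i | (i : ℕ) + 1 < n})
  /-- `vᵢ · vₙ = 0` for `1 ≤ i ≤ n - 2` -/
  orthogonal : ∀ i j : Fin n, (i : ℕ) + 2 < n → (j : ℕ) + 1 = n → inner ℝ (v i) (v j) = 0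
  /-- `xᵀ M x = ‖[ε₁ v₁, …, εₙ vₙ] x‖²` for suitable signs `εᵢ` -/
  quadratic : ∃ ε : Fin n → ℤˣ, ∀ x : Fin n → ℝ,
    x ⬝ᵥ (assocMatrix v *ᵥ x) = ‖∑ i, (((ε i : ℤ) : ℝ) * x i) • v i‖ ^ 2

/-- `IsFirstDecomposition w s C`: the cones `C₁, …, C_N` with the signs `s₁, …, s_N` form a
decomposition of the kind given by the first method of the cone generated by `w₁, …, wₙ`:
the indicator functions satisfy `[𝔠(w₁, …, wₙ)] = ∑ sᵢ [Cᵢ]`, and each piece either contains lines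
or is generated by vectors `v₁, …, vₙ` with positive definite associated matrix as above. -/
structure IsFirstDecomposition {n N : ℕ} (w : Fin n → Euc n) (s : Fin N → ℤˣ)
    (C : Fin N → PointedCone ℝ (Euc n)) : Prop where
  indicator_eq : ∀ x : Euc n,
    Set.indicator (genCone w : Set (Euc n)) (fun _ => (1 : ℤ)) x =
      ∑ i, (s i : ℤ) * Set.indicator (C i : Set (Euc n)) (fun _ => (1 : ℤ)) x
  forms : ∀ i, IsConeWithLine (C i) ∨ ∃ v : Fin n → Euc n, IsDefiniteForm w v ∧ C i = genCone v

/-- The orthogonal sum `φ(C') ⊕ L` in `ℝⁿ` of (a copy of) a cone `C'` in `ℝᵐ` and the linear subspace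
`L`, the orthogonal complement of the range of the linear isometric embedding `φ : ℝᵐ → ℝⁿ`. -/
def orthSumCone {m n : ℕ} (φ : Euc m →ₗᵢ[ℝ] Euc n) (C' : PointedCone ℝ (Euc m)) :
    PointedCone ℝ (Euc n) :=
  PointedCone.map φ.toLinearMap C' ⊔
    PointedCone.ofSubmodule ((LinearMap.range φ.toLinearMap)ᗮ)

/-- `ComputesTo n C t`: the recursive procedure started at the cone `C` in `ℝⁿ` can end with the
value `t`. A cone with positive definite associated matrix is assigned the value of its (absolutely
convergent) power series; an orthogonal sum of a cone `C'` of a lower-dimensional space and a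
linear subspace gets the value of `C'`; the cone of linearly independent unit vectors
gets the signed sum of the values of the pieces of a decomposition of the first kind. -/
inductive ComputesTo : (n : ℕ) → PointedCone ℝ (Euc n) → ℝ → Prop
  | series {n : ℕ} (v : Fin n → Euc n) (norm_eq_one : ∀ i, ‖v i‖ = 1)
      (linInd : LinearIndependent ℝ v) (posDef : (assocMatrix v).PosDef)
      (absConv : Summable fun a : IndexPair n → ℕ => ‖seriesTerm v a‖) :
      ComputesTo n (genCone v) (seriesValue v)
  | reduce {m n : ℕ} (hmn : m < n) (φ : Euc m →ₗᵢ[ℝ] Euc n) (C' : PointedCone ℝ (Euc m)) (t : ℝ)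
      (h : ComputesTo m C' t) : ComputesTo n (orthSumCone φ C') t
  | decompose {n N : ℕ} (w : Fin n → Euc n) (norm_eq_one : ∀ i, ‖w i‖ = 1)
      (linInd : LinearIndependent ℝ w) (s : Fin N → ℤˣ) (C : Fin N → PointedCone ℝ (Euc n))
      (dec : IsFirstDecomposition w s C) (t : Fin N → ℝ) (h : ∀ i, ComputesTo n (C i) (t i)) :
      ComputesTo n (genCone w) (∑ i, ((s i : ℤ) : ℝ) * t i)

end

/-! The normalized solid angle of a measurable cone is its mass under the Gaussian probability
measure with density proportional to `exp (-‖x‖²)` (`solidAngle_eq_gaussianMeasure`). Additivity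
over signed decompositions is then linearity of the integral. Since the orthogonal projection of a
Gaussian is the Gaussian of the smaller space, an orthogonal linear summand does not change the
value (`solidAngle_orthSumCone`).

For a simplicial cone the substitution `x = ∑ yᵢ vᵢ` leads to an integral over the orthant.
Expanding the exponentials of the cross terms and integrating termwise gives the series. With
absolute values inside, the expansion sums to the exponential of minus the quadratic form of
`assocMatrix v`, so positive definiteness supplies the integrable majorant
(`solidAngle_genCone_eq_seriesValue`).

Decompositions come from two inclusion-exclusion identities in the plane of two generators
(`coneIndicator_genCone_of_pos`, `coneIndicator_genCone_of_neg`). Modulo cones with lines, they make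
generators orthogonal to a given one, until only neighbouring generators fail to be orthogonal
(`coneIndicator_genCone_mem`). The Gram matrix is then tridiagonal, and sign changes of the
generators turn it into `assocMatrix`, which is therefore positive definite.

The cones with lines produced in this way have simplicial bases in dimension `n - 1`
(`lineCone_eq_orthSumCone`), so strong induction on the dimension shows that the procedure reaches
the solid angle. Induction on `ComputesTo` shows that it reaches nothing else. -/

/-! ### Finitely generated cones -/

theorem mem_genCone_iff {n d : ℕ} {v : Fin d → Euc n} {x : Euc n} :
    x ∈ genCone v ↔ ∃ y : Fin d → ℝ, (∀ i, 0 ≤ y i) ∧ ∑ i, y i • v i = x := by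
  rw [genCone, PointedCone.hull, Submodule.mem_span_range_iff_exists_fun]
  constructor
  · rintro ⟨c, rfl⟩
    exact ⟨fun i => (c i : ℝ), fun i => (c i).2, rfl⟩
  · rintro ⟨y, hy, rfl⟩
    exact ⟨fun i => ⟨y i, hy i⟩, rfl⟩

theorem genCone_fg {n d : ℕ} (v : Fin d → Euc n) : (genCone v).FG :=
  Submodule.fg_span (Set.finite_range v)

theorem exists_eq_genCone_of_fg {n : ℕ} {C : PointedCone ℝ (Euc n)} (hC : C.FG) :
    ∃ (d : ℕ) (v : Fin d → Euc n), C = genCone v := by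
  obtain ⟨d, v, h⟩ := Submodule.fg_iff_exists_fin_generating_family.1 hC
  exact ⟨d, v, h.symm⟩

theorem measurableSet_of_fg {n : ℕ} {C : PointedCone ℝ (Euc n)} (hC : C.FG) :
    MeasurableSet (C : Set (Euc n)) := by
  obtain ⟨d, v, rfl⟩ := exists_eq_genCone_of_fg hC
  have h : ((genCone v : PointedCone ℝ (Euc n)) : Set (Euc n)) =
      (fun y : Fin d → ℝ => ∑ i, y i • v i) '' Set.Ici 0 := by
    ext x
    simp only [SetLike.mem_coe, mem_genCone_iff, Set.mem_image, Set.mem_Ici, Pi.le_def,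
      Pi.zero_apply]
  -- A continuous image of the σ-compact orthant is σ-compact, hence Borel; closedness of the cone
  -- is not needed.
  have hs : IsSigmaCompact ((fun y : Fin d → ℝ => ∑ i, y i • v i) '' Set.Ici 0) :=
    (isSigmaCompact_univ.of_isClosed_subset isClosed_Ici (Set.subset_univ _)).image (by fun_prop)
  rw [h]
  obtain ⟨K, hK, hU⟩ := hs
  rw [← hU]
  exact MeasurableSet.iUnion fun k => (hK k).measurableSet

/-! ### The solid angle as a Gaussian integral -/

theorem integral_gaussian_euc (n : ℕ) :
    ∫ x : Euc n, Real.exp (-‖x‖ ^ 2) = Real.pi ^ ((n : ℝ) / 2) := by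
  have := GaussianFourier.integral_rexp_neg_mul_sq_norm (V := Euc n) one_pos
  simpa using this

theorem integrable_gaussian_euc (n : ℕ) :
    Integrable fun x : Euc n => Real.exp (-‖x‖ ^ 2) := by
  -- A nonintegrable function would have integral `0` by convention, but the integral is a positive
  -- power of `π`.
  by_contra h
  have := integral_gaussian_euc n
  rw [integral_undef h] at this
  exact (Real.rpow_pos_of_pos Real.pi_pos _).ne this

/-- Polar coordinates: membership in a cone depends only on the direction and the Gaussian only on
the radius, so the integral factors. The radial factor does not involve `C` and cancels in the ratio
that defines the solid angle. -/
theorem setIntegral_gaussian_eq_toSphere {n : ℕ} {C : PointedCone ℝ (Euc n)}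
    (hC : MeasurableSet (C : Set (Euc n))) (hn : n ≠ 0) :
    ∫ x in (C : Set (Euc n)), Real.exp (-‖x‖ ^ 2) =
      (volume : Measure (Euc n)).toSphere.real
          ((Subtype.val : Metric.sphere (0 : Euc n) 1 → Euc n) ⁻¹' C) *
        ∫ r : Set.Ioi (0 : ℝ), Real.exp (-(r : ℝ) ^ 2) ∂(Measure.volumeIoiPow (n - 1)) := by
  have : Nontrivial (Euc n) := by
    have : Nonempty (Fin n) := ⟨⟨0, Nat.pos_of_ne_zero hn⟩⟩
    exact Module.nontrivial_of_finrank_pos (R := ℝ) (by simpa using Nat.pos_of_ne_zero hn)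
  have hd : Module.finrank ℝ (Euc n) = n := by simp
  set A := (Subtype.val : Metric.sphere (0 : Euc n) 1 → Euc n) ⁻¹' (C : Set (Euc n)) with hA
  have hAm : MeasurableSet A := measurable_subtype_coe hC
  have key := (volume : Measure (Euc n)).measurePreserving_homeomorphUnitSphereProd.integral_comp
    (Homeomorph.measurableEmbedding _)
    (fun p => A.indicator (fun _ => (1 : ℝ)) p.1 * Real.exp (-(p.2 : ℝ) ^ 2))
  rw [integral_prod_mul (f := A.indicator (fun _ => (1 : ℝ)))
    (g := fun r : Set.Ioi (0 : ℝ) => Real.exp (-(r : ℝ) ^ 2)), hd] at key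
  have hone : ∫ x, A.indicator (fun _ => (1 : ℝ)) x ∂(volume : Measure (Euc n)).toSphere =
      (volume : Measure (Euc n)).toSphere.real A := integral_indicator_one hAm
  rw [hone] at key
  rw [← key, ← integral_indicator hC]
  have hsub := integral_subtype_comap (μ := (volume : Measure (Euc n)))
    (measurableSet_singleton (0 : Euc n)).compl
    (fun x => (C : Set (Euc n)).indicator (fun x => Real.exp (-‖x‖ ^ 2)) x)
  rw [restrict_compl_singleton] at hsub
  rw [← hsub]
  refine integral_congr_ae (Filter.Eventually.of_forall fun x => ?_)
  have hx : 0 < ‖(x : Euc n)‖ := norm_pos_iff.2 x.2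
  simp only [homeomorphUnitSphereProd_apply_snd_coe]
  have hiff : (homeomorphUnitSphereProd (Euc n) x).1 ∈ A ↔ (x : Euc n) ∈ C := by
    rw [hA, Set.mem_preimage, homeomorphUnitSphereProd_apply_fst_coe]
    exact PointedCone.smul_mem_iff C (inv_pos.2 hx)
  by_cases hxC : (x : Euc n) ∈ C
  · rw [Set.indicator_of_mem (s := (C : Set (Euc n))) hxC, Set.indicator_of_mem (hiff.2 hxC), one_mul]
  · rw [Set.indicator_of_notMem (s := (C : Set (Euc n))) hxC,
      Set.indicator_of_notMem (fun h => hxC (hiff.1 h)), zero_mul]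

theorem solidAngle_eq_gaussian {n : ℕ} {C : PointedCone ℝ (Euc n)}
    (hC : MeasurableSet (C : Set (Euc n))) :
    solidAngle (C : Set (Euc n)) =
      (∫ x in (C : Set (Euc n)), Real.exp (-‖x‖ ^ 2)) / Real.pi ^ ((n : ℝ) / 2) := by
  by_cases hn : n = 0
  · subst hn
    have : (C : Set (Euc 0)) = Set.univ := by
      ext x
      rw [Subsingleton.elim x 0]
      simp
    rw [this, setIntegral_univ, integral_gaussian_euc, solidAngle, if_pos rfl, div_self]
    exact (Real.rpow_pos_of_pos Real.pi_pos _).ne'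
  · have h1 := setIntegral_gaussian_eq_toSphere hC hn
    have h2 := setIntegral_gaussian_eq_toSphere (C := (⊤ : PointedCone ℝ (Euc n)))
      MeasurableSet.univ hn
    rw [Submodule.top_coe, setIntegral_univ, integral_gaussian_euc, Set.preimage_univ] at h2
    have hpos := Real.rpow_pos_of_pos Real.pi_pos ((n : ℝ) / 2)
    rw [h1, solidAngle, if_neg hn, h2, mul_div_mul_right]
    · rfl
    -- The radial factor is nonzero because its product with the area of the sphere is the full
    -- Gaussian integral.
    · rintro h0
      rw [h0, mul_zero] at h2
      exact hpos.ne' h2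

/-! ### Orthogonal sums with linear subspaces -/

theorem adjoint_eq_zero_iff {m n : ℕ} (φ : Euc m →ₗᵢ[ℝ] Euc n) (x : Euc n) :
    φ.toContinuousLinearMap.adjoint x = 0 ↔ x ∈ (LinearMap.range φ.toLinearMap)ᗮ := by
  rw [Submodule.mem_orthogonal']
  constructor
  · rintro h _ ⟨z, rfl⟩
    have := ContinuousLinearMap.adjoint_inner_left φ.toContinuousLinearMap z x
    rw [h, inner_zero_left] at this
    exact this.symm
  · intro h
    refine ext_inner_right ℝ fun z => ?_
    rw [ContinuousLinearMap.adjoint_inner_left, inner_zero_left]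
    exact h _ ⟨z, rfl⟩

/-- The adjoint of `φ` is a left inverse of `φ` whose kernel is the complementary subspace, so the
orthogonal sum is a preimage under it. -/
theorem mem_orthSumCone_iff {m n : ℕ} (φ : Euc m →ₗᵢ[ℝ] Euc n) (C' : PointedCone ℝ (Euc m))
    (x : Euc n) :
    x ∈ orthSumCone φ C' ↔ φ.toContinuousLinearMap.adjoint x ∈ C' := by
  set ψ := φ.toContinuousLinearMap.adjoint with hψ
  have hinv : ∀ y, ψ (φ y) = y := fun y => ext_inner_right ℝ fun z => by
    rw [hψ, ContinuousLinearMap.adjoint_inner_left]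
    exact φ.inner_map_map y z
  have hker : ∀ l, l ∈ (LinearMap.range φ.toLinearMap)ᗮ ↔ ψ l = 0 :=
    fun l => (adjoint_eq_zero_iff φ l).symm
  rw [orthSumCone, Submodule.mem_sup]
  constructor
  · rintro ⟨y, hy, l, hl, rfl⟩
    obtain ⟨c, hc, rfl⟩ := PointedCone.mem_map.1 hy
    have h0 : ψ l = 0 := (hker l).1 hl
    have h1 : ψ (φ.toLinearMap c) = c := hinv c
    rwa [map_add, h0, h1, add_zero]
  · intro h
    refine ⟨φ (ψ x), PointedCone.mem_map.2 ⟨_, h, rfl⟩, x - φ (ψ x), ?_, add_sub_cancel _ _⟩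
    refine (hker _).2 ?_
    rw [map_sub, hinv, sub_self]

theorem orthSumCone_fg {m n : ℕ} (φ : Euc m →ₗᵢ[ℝ] Euc n) {C' : PointedCone ℝ (Euc m)}
    (h : C'.FG) : (orthSumCone φ C').FG :=
  Submodule.FG.sup (h.map _)
    (Submodule.FG.restrictScalars (IsNoetherian.noetherian _))

/-- The centred Gaussian probability measure on `ℝⁿ` with density proportional to `exp (-‖x‖²)`. -/
noncomputable def gaussianMeasure (n : ℕ) : Measure (Euc n) :=
  volume.withDensity fun x => ENNReal.ofReal (Real.exp (-‖x‖ ^ 2) / Real.pi ^ ((n : ℝ) / 2))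

theorem gaussianMeasure_apply {n : ℕ} {s : Set (Euc n)} (hs : MeasurableSet s) :
    gaussianMeasure n s =
      ENNReal.ofReal ((∫ x in s, Real.exp (-‖x‖ ^ 2)) / Real.pi ^ ((n : ℝ) / 2)) := by
  rw [gaussianMeasure, withDensity_apply _ hs, ← integral_div,
    ofReal_integral_eq_lintegral_ofReal]
  · exact ((integrable_gaussian_euc n).div_const _).integrableOn
  · exact Filter.Eventually.of_forall fun x => by positivity

instance (n : ℕ) : IsProbabilityMeasure (gaussianMeasure n) where
  measure_univ := by
    rw [gaussianMeasure_apply MeasurableSet.univ, setIntegral_univ, integral_gaussian_euc, div_self,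
      ENNReal.ofReal_one]
    exact (Real.rpow_pos_of_pos Real.pi_pos _).ne'

theorem solidAngle_eq_gaussianMeasure {n : ℕ} {C : PointedCone ℝ (Euc n)}
    (hC : MeasurableSet (C : Set (Euc n))) :
    solidAngle (C : Set (Euc n)) = (gaussianMeasure n).real C := by
  rw [solidAngle_eq_gaussian hC, Measure.real, gaussianMeasure_apply hC, ENNReal.toReal_ofReal]
  exact div_nonneg (integral_nonneg fun _ => (Real.exp_pos _).le)
    (Real.rpow_nonneg Real.pi_pos.le _)

theorem charFun_gaussianMeasure (n : ℕ) (t : Euc n) :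
    charFun (gaussianMeasure n) t = Complex.exp (-‖t‖ ^ 2 / 4) := by
  have hmeas : Measurable fun x : Euc n =>
      ENNReal.ofReal (Real.exp (-‖x‖ ^ 2) / Real.pi ^ ((n : ℝ) / 2)) := by fun_prop
  have h := GaussianFourier.integral_cexp_neg_mul_sq_norm_add (V := Euc n) (b := 1) (by simp)
    Complex.I t
  have hpi : (Real.pi : ℂ) ^ ((n : ℂ) / 2) = ((Real.pi ^ ((n : ℝ) / 2) : ℝ) : ℂ) := by
    rw [Complex.ofReal_cpow Real.pi_pos.le]; push_cast; rfl
  rw [finrank_euclideanSpace_fin, div_one, hpi] at h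
  have hpos := Real.rpow_pos_of_pos Real.pi_pos ((n : ℝ) / 2)
  have hne : ((Real.pi ^ ((n : ℝ) / 2) : ℝ) : ℂ) ≠ 0 := Complex.ofReal_ne_zero.2 hpos.ne'
  rw [charFun_apply, gaussianMeasure, integral_withDensity_eq_integral_toReal_smul hmeas (by simp)]
  calc _ = ∫ x : Euc n, Complex.exp (-1 * (‖x‖ : ℂ) ^ 2 + Complex.I * (inner ℝ t x : ℝ)) /
        ((Real.pi ^ ((n : ℝ) / 2) : ℝ) : ℂ) := by
        refine integral_congr_ae (Filter.Eventually.of_forall fun x => ?_)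
        simp only
        rw [ENNReal.toReal_ofReal (by positivity), Complex.real_smul, Complex.ofReal_div,
          Complex.exp_add, real_inner_comm, mul_comm Complex.I, Complex.ofReal_exp]
        push_cast
        ring_nf
    _ = _ := by
        rw [integral_div, h, mul_div_cancel_left₀ _ hne, Complex.I_sq]
        ring_nf

/-- Characteristic functions determine the measures: moving the adjoint across the inner product
replaces `t` by `φ t`, which has the same norm, and the Gaussian characteristic function depends
only on that norm. -/
theorem gaussianMeasure_map_adjoint {m n : ℕ} (φ : Euc m →ₗᵢ[ℝ] Euc n) :
    (gaussianMeasure n).map φ.toContinuousLinearMap.adjoint = gaussianMeasure m := by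
  have hm : Measurable φ.toContinuousLinearMap.adjoint :=
    (ContinuousLinearMap.continuous _).measurable
  have : IsProbabilityMeasure ((gaussianMeasure n).map φ.toContinuousLinearMap.adjoint) :=
    Measure.isProbabilityMeasure_map hm.aemeasurable
  refine Measure.ext_of_charFun (funext fun t => ?_)
  rw [charFun_apply, integral_map hm.aemeasurable (by fun_prop)]
  simp only [ContinuousLinearMap.adjoint_inner_left]
  have := charFun_gaussianMeasure n (φ t)
  rw [charFun_apply] at this
  rw [charFun_gaussianMeasure, ← φ.norm_map t, ← this]
  rfl

theorem solidAngle_orthSumCone {m n : ℕ} (φ : Euc m →ₗᵢ[ℝ] Euc n) {C' : PointedCone ℝ (Euc m)}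
    (hC' : MeasurableSet (C' : Set (Euc m))) :
    solidAngle (orthSumCone φ C' : Set (Euc n)) = solidAngle (C' : Set (Euc m)) := by
  have hm : Measurable φ.toContinuousLinearMap.adjoint :=
    (ContinuousLinearMap.continuous _).measurable
  have hpre : (orthSumCone φ C' : Set (Euc n)) = φ.toContinuousLinearMap.adjoint ⁻¹' C' := by
    ext x
    exact mem_orthSumCone_iff φ C' x
  rw [solidAngle_eq_gaussianMeasure hC', solidAngle_eq_gaussianMeasure (hpre ▸ hm hC'), hpre,
    ← gaussianMeasure_map_adjoint φ, Measure.real, Measure.real, Measure.map_apply hm hC']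

/-- Needed for bases `C'` that are not assumed finitely generated: `C'` is the preimage of the
orthogonal sum under `φ`. -/
theorem measurableSet_of_orthSumCone {m n : ℕ} (φ : Euc m →ₗᵢ[ℝ] Euc n)
    {C' : PointedCone ℝ (Euc m)} (h : MeasurableSet (orthSumCone φ C' : Set (Euc n))) :
    MeasurableSet (C' : Set (Euc m)) := by
  have hpre : (C' : Set (Euc m)) = φ ⁻¹' (orthSumCone φ C' : Set (Euc n)) := by
    ext y
    have hy : φ.toContinuousLinearMap.adjoint (φ y) = y := ext_inner_right ℝ fun z => by
      rw [ContinuousLinearMap.adjoint_inner_left]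
      exact φ.inner_map_map y z
    rw [Set.mem_preimage, SetLike.mem_coe, SetLike.mem_coe, mem_orthSumCone_iff, hy]
  rw [hpre]
  exact φ.continuous.measurable h

theorem exists_linearIsometry_range_eq {m : ℕ} {u : Euc (m + 1)} (hu : u ≠ 0) :
    ∃ φ : Euc m →ₗᵢ[ℝ] Euc (m + 1), LinearMap.range φ.toLinearMap = (ℝ ∙ u)ᗮ := by
  have hfin : Fact (Module.finrank ℝ (Euc (m + 1)) = m + 1) := ⟨by simp⟩
  let e := (stdOrthonormalBasis ℝ (ℝ ∙ u)ᗮ).reindex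
    (finCongr (Submodule.finrank_orthogonal_span_singleton (n := m) hu))
  refine ⟨(ℝ ∙ u)ᗮ.subtypeₗᵢ.comp e.repr.symm.toLinearIsometry, ?_⟩
  ext x
  constructor
  · rintro ⟨y, rfl⟩
    exact (e.repr.symm y).2
  · intro hx
    exact ⟨e.repr ⟨x, hx⟩, by simp⟩

/-- Splitting off a single line is enough: `C` is invariant under translation along it, hence is the
preimage of its own projection to the hyperplane orthogonal to the line. -/
theorem isConeWithLine_eq_orthSumCone {n : ℕ} {C : PointedCone ℝ (Euc n)} (hC : IsConeWithLine C) :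
    ∃ m < n, ∃ (φ : Euc m →ₗᵢ[ℝ] Euc n) (C' : PointedCone ℝ (Euc m)),
      C'.FG ∧ C = orthSumCone φ C' := by
  obtain ⟨hfg, u, hu, huC, hnC⟩ := hC
  obtain _ | m := n
  · exact absurd (Subsingleton.elim u 0) hu
  obtain ⟨φ, hrange⟩ := exists_linearIsometry_range_eq hu
  have hline : ∀ c : ℝ, c • u ∈ C := by
    intro c
    rcases le_total 0 c with h | h
    · exact C.smul_mem h huC
    · have := C.smul_mem (neg_nonneg.2 h) hnC
      rwa [smul_neg, neg_smul, neg_neg] at this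
  have hmem : ∀ x l, l ∈ (LinearMap.range φ.toLinearMap)ᗮ → (x + l ∈ C ↔ x ∈ C) := by
    intro x l hl
    rw [hrange, Submodule.orthogonal_orthogonal] at hl
    obtain ⟨c, rfl⟩ := Submodule.mem_span_singleton.1 hl
    constructor
    · intro h
      have := C.add_mem h (hline (-c))
      rwa [neg_smul, add_neg_cancel_right] at this
    · intro h
      exact C.add_mem h (hline c)
  have hdiff : ∀ x, x - φ (φ.toContinuousLinearMap.adjoint x) ∈
      (LinearMap.range φ.toLinearMap)ᗮ := by
    intro x
    rw [Submodule.mem_orthogonal']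
    rintro _ ⟨z, rfl⟩
    have h1 := ContinuousLinearMap.adjoint_inner_left φ.toContinuousLinearMap z x
    have h2 := φ.inner_map_map (φ.toContinuousLinearMap.adjoint x) z
    change inner ℝ _ (φ z) = 0
    rw [inner_sub_left, h2, h1]
    exact sub_self _
  refine ⟨m, Nat.lt_succ_self m, φ,
    C.map φ.toContinuousLinearMap.adjoint.toLinearMap, hfg.map _, ?_⟩
  ext x
  rw [mem_orthSumCone_iff, PointedCone.mem_map]
  constructor
  · intro hx
    exact ⟨x, hx, rfl⟩
  · rintro ⟨y, hy, hyx⟩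
    have hyx' : φ.toContinuousLinearMap.adjoint y = φ.toContinuousLinearMap.adjoint x := hyx
    have h1 := hmem (φ (φ.toContinuousLinearMap.adjoint y)) _ (hdiff y)
    have h2 := hmem (φ (φ.toContinuousLinearMap.adjoint x)) _ (hdiff x)
    rw [add_sub_cancel] at h1 h2
    exact h2.2 (hyx' ▸ h1.1 hy)

/-! ### The power series of a simplicial cone -/

theorem sum_sum_eq_diag_add_indexPair {n : ℕ} (f : Fin n → Fin n → ℝ) (hf : ∀ i j, f i j = f j i) :
    ∑ i, ∑ j, f i j = ∑ i, f i i + 2 * ∑ p : IndexPair n, f p.1.1 p.1.2 := by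
  have hlt : ∑ p : IndexPair n, f p.1.1 p.1.2 =
      ∑ i, ∑ j, if i < j then f i j else 0 := by
    rw [← Finset.sum_product', Finset.univ_product_univ, ← Finset.sum_filter]
    exact (Finset.sum_subtype (Finset.univ.filter fun p : Fin n × Fin n => p.1 < p.2)
      (fun p => by simp) (fun p => f p.1 p.2)).symm
  have hgt : ∑ i, ∑ j, (if j < i then f i j else 0) = ∑ i, ∑ j, if i < j then f i j else 0 := by
    rw [Finset.sum_comm]
    simp only [hf]
  have hdiag : ∑ i, f i i = ∑ i, ∑ j, if i = j then f i j else 0 := by simp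
  rw [hlt, hdiag, two_mul]
  nth_rewrite 2 [← hgt]
  simp only [← Finset.sum_add_distrib]
  refine Finset.sum_congr rfl fun i _ => Finset.sum_congr rfl fun j _ => ?_
  rcases lt_trichotomy i j with h | h | h
  · simp [h, h.ne, h.not_gt]
  · simp [h]
  · simp [h, h.ne', h.not_gt]

theorem norm_sq_sum_smul {n d : ℕ} (v : Fin d → Euc n) (y : Fin d → ℝ) :
    ‖∑ i, y i • v i‖ ^ 2 = ∑ i, ∑ j, y i * y j * inner ℝ (v i) (v j) := by
  rw [← real_inner_self_eq_norm_sq, sum_inner]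
  refine Finset.sum_congr rfl fun i _ => ?_
  rw [inner_sum]
  refine Finset.sum_congr rfl fun j _ => ?_
  rw [real_inner_smul_left, real_inner_smul_right]
  ring

theorem norm_sq_sum_smul_of_unit {n d : ℕ} {v : Fin d → Euc n} (hv : ∀ i, ‖v i‖ = 1)
    (y : Fin d → ℝ) :
    ‖∑ i, y i • v i‖ ^ 2 = ∑ i, y i ^ 2 +
      2 * ∑ p : IndexPair d, inner ℝ (v p.1.1) (v p.1.2) * (y p.1.1 * y p.1.2) := by
  rw [norm_sq_sum_smul, sum_sum_eq_diag_add_indexPair _ fun i j => by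
    rw [real_inner_comm, mul_comm (y i)]]
  congr 1
  · refine Finset.sum_congr rfl fun i _ => ?_
    rw [real_inner_self_eq_norm_sq, hv]
    ring
  · congr 1
    exact Finset.sum_congr rfl fun p _ => mul_comm _ _

theorem dotProduct_assocMatrix_mulVec {n : ℕ} (v : Fin n → Euc n) (y : Fin n → ℝ) :
    y ⬝ᵥ (assocMatrix v *ᵥ y) = ∑ i, y i ^ 2 -
      2 * ∑ p : IndexPair n, |inner ℝ (v p.1.1) (v p.1.2)| * (y p.1.1 * y p.1.2) := by
  have h : y ⬝ᵥ (assocMatrix v *ᵥ y) = ∑ i, ∑ j, y i * y j * assocMatrix v i j := by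
    simp only [dotProduct, Matrix.mulVec, Finset.mul_sum]
    exact Finset.sum_congr rfl fun i _ => Finset.sum_congr rfl fun j _ => by ring
  rw [h, sum_sum_eq_diag_add_indexPair _ fun i j => by
    simp only [assocMatrix, Matrix.of_apply, real_inner_comm (v i), eq_comm (a := i),
      mul_comm (y i)]]
  rw [sub_eq_add_neg, ← mul_neg, ← Finset.sum_neg_distrib]
  congr 1
  · refine Finset.sum_congr rfl fun i _ => ?_
    simp [assocMatrix, sq]
  · congr 1
    refine Finset.sum_congr rfl fun p _ => ?_
    simp only [assocMatrix, Matrix.of_apply, if_neg p.2.ne]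
    ring

/-- The product of the exponential series, obtained from Fubini: counting measure on `ι → ℕ` is the
product of the counting measures on `ℕ`, and integrability for it is absolute summability. -/
theorem hasSum_prod_exp_series {ι : Type*} [Fintype ι] (z : ι → ℝ) :
    HasSum (fun a : ι → ℕ => ∏ p, z p ^ a p / ((a p).factorial : ℝ)) (Real.exp (∑ p, z p)) := by
  have hpi : (Measure.pi fun _ : ι => (Measure.count : Measure ℕ)) = Measure.count := by
    refine Measure.ext_of_singleton fun a => ?_
    rw [Measure.pi_singleton]
    simp
  have hone : ∀ x : ℝ, Integrable (fun k : ℕ => x ^ k / (k.factorial : ℝ)) Measure.count := by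
    intro x
    rw [integrable_count_iff]
    exact (Real.summable_pow_div_factorial x).norm
  have hint : Integrable (fun a : ι → ℕ => ∏ p, z p ^ a p / ((a p).factorial : ℝ))
      (Measure.count : Measure (ι → ℕ)) := by
    rw [← hpi]
    exact Integrable.fintype_prod_dep (f := fun p k => z p ^ k / (k.factorial : ℝ))
      fun p => hone (z p)
  have hsum := (integrable_count_iff.1 hint).of_norm
  have hval : ∑' a : ι → ℕ, ∏ p, z p ^ a p / ((a p).factorial : ℝ) = Real.exp (∑ p, z p) := by
    have h1 := integral_countable hint
    have h2 := integral_fintype_prod_eq_prod (μ := fun _ : ι => (Measure.count : Measure ℕ))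
      (fun p k => z p ^ k / (k.factorial : ℝ))
    rw [hpi] at h2
    rw [h2] at h1
    simp only [Measure.real, Measure.count_singleton, ENNReal.toReal_one, one_smul] at h1
    rw [← h1, Real.exp_sum]
    refine Finset.prod_congr rfl fun p _ => ?_
    rw [integral_countable (hone (z p))]
    simp only [Measure.real, Measure.count_singleton, ENNReal.toReal_one, one_smul]
    rw [Real.exp_eq_exp_ℝ, NormedSpace.exp_eq_tsum_div]
  rw [← hval]
  exact hsum.hasSum

/-- The exponent of the variable `yᵢ` in the monomial `∏_{i<j} (yᵢ yⱼ) ^ aᵢⱼ`. -/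
def pairDegree {n : ℕ} (a : IndexPair n → ℕ) (i : Fin n) : ℕ :=
  ∑ p : IndexPair n, if p.1.1 = i ∨ p.1.2 = i then a p else 0

theorem prod_pair_pow {n : ℕ} (a : IndexPair n → ℕ) (y : Fin n → ℝ) :
    ∏ p : IndexPair n, (y p.1.1 * y p.1.2) ^ a p = ∏ i, y i ^ pairDegree a i := by
  simp only [pairDegree, ← Finset.prod_pow_eq_pow_sum]
  rw [Finset.prod_comm]
  refine Finset.prod_congr rfl fun p _ => ?_
  have : ∀ i, y i ^ (if p.1.1 = i ∨ p.1.2 = i then a p else 0) =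
      (if p.1.1 = i then y i ^ a p else 1) * (if p.1.2 = i then y i ^ a p else 1) := by
    intro i
    by_cases h1 : p.1.1 = i
    -- The two indices of a pair differ, so the disjunction in `pairDegree` never counts an index
    -- twice.
    · have h2 : p.1.2 ≠ i := fun h => p.2.ne (h1.trans h.symm)
      simp [h1, h2]
    · by_cases h2 : p.1.2 = i <;> simp [h1, h2]
  simp only [this, Finset.prod_mul_distrib, mul_pow]
  simp

theorem integral_pow_mul_exp_neg_sq (k : ℕ) :
    ∫ x in Set.Ici (0 : ℝ), x ^ k * Real.exp (-x ^ 2) = Real.Gamma ((1 + (k : ℝ)) / 2) / 2 := by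
  have h := integral_rpow_mul_exp_neg_rpow (p := 2) (q := (k : ℝ)) two_pos
    (by have : (0 : ℝ) ≤ k := Nat.cast_nonneg k
        linarith)
  rw [integral_Ici_eq_integral_Ioi]
  simp only [Real.rpow_natCast, Real.rpow_two] at h
  rw [h, add_comm]
  ring

theorem setIntegral_Ici_prod {n : ℕ} (f : Fin n → ℝ → ℝ) :
    ∫ y in Set.Ici (0 : Fin n → ℝ), ∏ i, f i (y i) = ∏ i, ∫ x in Set.Ici (0 : ℝ), f i x := by
  have : (volume : Measure (Fin n → ℝ)).restrict (Set.Ici 0) =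
      Measure.pi fun _ => (volume : Measure ℝ).restrict (Set.Ici 0) := by
    rw [volume_pi, ← Set.pi_univ_Ici, Measure.restrict_pi_pi]
    rfl
  rw [this]
  exact integral_fintype_prod_eq_prod f

/-- The term of multiexponent `a` in the expansion of `exp (-‖∑ yᵢ vᵢ‖²)`; its integral over the orthant
is `seriesTerm v a / 2 ^ n`. -/
noncomputable def monomialTerm {n : ℕ} (v : Fin n → Euc n) (a : IndexPair n → ℕ)
    (y : Fin n → ℝ) : ℝ :=
  (∏ p : IndexPair n, (-2 * inner ℝ (v p.1.1) (v p.1.2) * (y p.1.1 * y p.1.2)) ^ a p /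
    ((a p).factorial : ℝ)) * ∏ i, Real.exp (-y i ^ 2)

theorem monomialTerm_eq {n : ℕ} (v : Fin n → Euc n) (a : IndexPair n → ℕ) (y : Fin n → ℝ) :
    monomialTerm v a y =
      ((-2 : ℝ) ^ (∑ p, a p) / (∏ p, ((a p).factorial : ℝ)) *
        ∏ p : IndexPair n, (inner ℝ (v p.1.1) (v p.1.2)) ^ (a p)) *
      ∏ i, (y i ^ pairDegree a i * Real.exp (-y i ^ 2)) := by
  rw [monomialTerm, Finset.prod_mul_distrib, ← prod_pair_pow, Finset.prod_div_distrib,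
    ← Finset.prod_pow_eq_pow_sum]
  simp only [mul_pow, Finset.prod_mul_distrib]
  ring

theorem integral_monomialTerm {n : ℕ} (v : Fin n → Euc n) (a : IndexPair n → ℕ) :
    ∫ y in Set.Ici (0 : Fin n → ℝ), monomialTerm v a y = seriesTerm v a / 2 ^ n := by
  simp only [monomialTerm_eq]
  rw [integral_const_mul, setIntegral_Ici_prod fun i x => x ^ pairDegree a i * Real.exp (-x ^ 2)]
  simp only [integral_pow_mul_exp_neg_sq, Finset.prod_div_distrib, Finset.prod_const,
    Finset.card_univ, Fintype.card_fin, seriesTerm, pairDegree, Nat.cast_sum, Nat.cast_ite,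
    Nat.cast_zero]
  ring

/-- On the orthant the monomials and the exponentials are nonnegative, so the norm only affects the
constant coefficient. -/
theorem integral_norm_monomialTerm {n : ℕ} (v : Fin n → Euc n) (a : IndexPair n → ℕ) :
    ∫ y in Set.Ici (0 : Fin n → ℝ), ‖monomialTerm v a y‖ = ‖seriesTerm v a‖ / 2 ^ n := by
  obtain ⟨c, hc⟩ : ∃ c, c = (-2 : ℝ) ^ (∑ p, a p) / (∏ p, ((a p).factorial : ℝ)) *
    ∏ p : IndexPair n, (inner ℝ (v p.1.1) (v p.1.2)) ^ (a p) := ⟨_, rfl⟩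
  have h1 : ∫ y in Set.Ici (0 : Fin n → ℝ), ‖monomialTerm v a y‖ =
      ∫ y in Set.Ici (0 : Fin n → ℝ), ‖c‖ * ∏ i, (y i ^ pairDegree a i * Real.exp (-y i ^ 2)) := by
    refine setIntegral_congr_fun measurableSet_Ici fun y hy => ?_
    simp only [monomialTerm_eq]
    rw [norm_mul, ← hc]
    congr 1
    exact Real.norm_of_nonneg (Finset.prod_nonneg fun i _ =>
      mul_nonneg (pow_nonneg (hy i) _) (Real.exp_pos _).le)
  rw [h1, integral_const_mul,
    setIntegral_Ici_prod fun i x => x ^ pairDegree a i * Real.exp (-x ^ 2)]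
  have h2 : seriesTerm v a = c * ∏ i, Real.Gamma ((1 + (pairDegree a i : ℝ)) / 2) := by
    simp only [seriesTerm, pairDegree, Nat.cast_sum, Nat.cast_ite, Nat.cast_zero, hc]
    ring
  have h3 : 0 ≤ ∏ i, Real.Gamma ((1 + (pairDegree a i : ℝ)) / 2) :=
    Finset.prod_nonneg fun i _ => Real.Gamma_nonneg_of_nonneg (by positivity)
  simp only [integral_pow_mul_exp_neg_sq, Finset.prod_div_distrib, Finset.prod_const,
    Finset.card_univ, Fintype.card_fin]
  rw [h2, norm_mul c, Real.norm_of_nonneg h3]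
  ring

theorem hasSum_monomialTerm {n : ℕ} {v : Fin n → Euc n} (hv : ∀ i, ‖v i‖ = 1) (y : Fin n → ℝ) :
    HasSum (fun a => monomialTerm v a y) (Real.exp (-‖∑ i, y i • v i‖ ^ 2)) := by
  have h := (hasSum_prod_exp_series fun p : IndexPair n =>
    -2 * inner ℝ (v p.1.1) (v p.1.2) * (y p.1.1 * y p.1.2)).mul_right (∏ i, Real.exp (-y i ^ 2))
  have he : Real.exp (-‖∑ i, y i • v i‖ ^ 2) =
      Real.exp (∑ p : IndexPair n, -2 * inner ℝ (v p.1.1) (v p.1.2) * (y p.1.1 * y p.1.2)) *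
        ∏ i, Real.exp (-y i ^ 2) := by
    rw [← Real.exp_sum, ← Real.exp_add, norm_sq_sum_smul_of_unit hv, Finset.mul_sum,
      neg_add, add_comm, ← Finset.sum_neg_distrib, ← Finset.sum_neg_distrib]
    congr 2
    exact Finset.sum_congr rfl fun p _ => by ring
  rw [he]
  exact h

/-- This is where the associated matrix enters: taking norms replaces each `-2 αᵢⱼ` by `2 |αᵢⱼ|`,
and the full expansion then sums to the right-hand side. -/
theorem sum_norm_monomialTerm_le {n : ℕ} (v : Fin n → Euc n) {y : Fin n → ℝ} (hy : 0 ≤ y)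
    (s : Finset (IndexPair n → ℕ)) :
    ∑ a ∈ s, ‖monomialTerm v a y‖ ≤ Real.exp (-(y ⬝ᵥ (assocMatrix v *ᵥ y))) := by
  have h := (hasSum_prod_exp_series fun p : IndexPair n =>
    2 * |inner ℝ (v p.1.1) (v p.1.2)| * (y p.1.1 * y p.1.2)).mul_right (∏ i, Real.exp (-y i ^ 2))
  have he : Real.exp (-(y ⬝ᵥ (assocMatrix v *ᵥ y))) =
      Real.exp (∑ p : IndexPair n, 2 * |inner ℝ (v p.1.1) (v p.1.2)| * (y p.1.1 * y p.1.2)) *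
        ∏ i, Real.exp (-y i ^ 2) := by
    rw [← Real.exp_sum, ← Real.exp_add, dotProduct_assocMatrix_mulVec, Finset.mul_sum, neg_sub,
      sub_eq_add_neg, ← Finset.sum_neg_distrib]
    congr 2
    exact Finset.sum_congr rfl fun p _ => by ring
  have hn : ∀ a, ‖monomialTerm v a y‖ = (∏ p : IndexPair n,
      (2 * |inner ℝ (v p.1.1) (v p.1.2)| * (y p.1.1 * y p.1.2)) ^ a p /
        ((a p).factorial : ℝ)) * ∏ i, Real.exp (-y i ^ 2) := by
    intro a
    rw [monomialTerm, norm_mul, Real.norm_of_nonneg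
      (Finset.prod_nonneg fun i _ => (Real.exp_pos (-y i ^ 2)).le), norm_prod]
    congr 1
    refine Finset.prod_congr rfl fun p _ => ?_
    rw [norm_div, norm_pow, norm_mul, norm_mul, Real.norm_of_nonneg (mul_nonneg (hy _) (hy _)),
      Real.norm_of_nonneg (Nat.cast_nonneg _)]
    simp
  rw [he]
  simp only [hn]
  refine sum_le_hasSum s (fun a _ => ?_) h
  rw [← hn]
  exact norm_nonneg _

theorem integrable_exp_neg_quadratic {n : ℕ} {M : Matrix (Fin n) (Fin n) ℝ} (hM : M.PosDef) :
    Integrable fun y : Fin n → ℝ => Real.exp (-(y ⬝ᵥ (M *ᵥ y))) := by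
  -- `c` is the minimum of the form on the unit sphere, extended to all vectors by homogeneity.
  obtain ⟨c, hc, hq⟩ : ∃ c > 0, ∀ y : Euc n, c * ‖y‖ ^ 2 ≤ y.ofLp ⬝ᵥ (M *ᵥ y.ofLp) := by
    by_cases hn : n = 0
    · subst hn
      exact ⟨1, one_pos, fun y => by simp [Subsingleton.elim y 0]⟩
    have hne : (Metric.sphere (0 : Euc n) 1).Nonempty := by
      have : Nontrivial (Euc n) :=
        Module.nontrivial_of_finrank_pos (R := ℝ) (by simpa using Nat.pos_of_ne_zero hn)
      exact NormedSpace.sphere_nonempty.2 zero_le_one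
    have hcont : Continuous fun y : Euc n => y.ofLp ⬝ᵥ (M *ᵥ y.ofLp) := by
      simp only [dotProduct, Matrix.mulVec]
      fun_prop
    obtain ⟨u, hu, hmin⟩ := (isCompact_sphere (0 : Euc n) 1).exists_isMinOn hne hcont.continuousOn
    have hpos : ∀ y : Euc n, y ≠ 0 → 0 < y.ofLp ⬝ᵥ (M *ᵥ y.ofLp) := by
      intro y hy
      have := hM.dotProduct_mulVec_pos (x := y.ofLp) (fun h => hy (by ext i; simp [h]))
      simpa using this
    refine ⟨_, hpos u (fun h => by simp [h] at hu), fun y => ?_⟩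
    by_cases hy : y = 0
    · simp [hy]
    have hy' : 0 < ‖y‖ := norm_pos_iff.2 hy
    have h1 := hmin (show ‖y‖⁻¹ • y ∈ Metric.sphere (0 : Euc n) 1 by
      simp [norm_smul, hy'.ne'])
    simp only [Set.mem_ofPred_eq, WithLp.ofLp_smul, Matrix.mulVec_smul,
      dotProduct_smul, smul_dotProduct, smul_eq_mul] at h1
    calc _ ≤ (‖y‖⁻¹ * (‖y‖⁻¹ * (y.ofLp ⬝ᵥ (M *ᵥ y.ofLp)))) * ‖y‖ ^ 2 := by gcongr
      _ = _ := by field_simp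
  have hg : Integrable fun y : Euc n => Real.exp (-(y.ofLp ⬝ᵥ (M *ᵥ y.ofLp))) := by
    have hG : Integrable fun y : Euc n => Real.exp (-c * ‖y‖ ^ 2) := by
      by_contra h
      have := GaussianFourier.integral_rexp_neg_mul_sq_norm (V := Euc n) hc
      rw [integral_undef h] at this
      exact (Real.rpow_pos_of_pos (div_pos Real.pi_pos hc) _).ne this
    refine hG.mono' ?_ (Filter.Eventually.of_forall fun y => ?_)
    · refine Continuous.aestronglyMeasurable ?_
      simp only [dotProduct, Matrix.mulVec]
      fun_prop
    · rw [Real.norm_of_nonneg (Real.exp_pos _).le]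
      exact Real.exp_le_exp.2 (by linarith [hq y])
  exact ((PiLp.volume_preserving_toLp (Fin n)).integrable_comp_emb
    (MeasurableEquiv.toLp 2 _).measurableEmbedding).2 hg

theorem setIntegral_genCone {n : ℕ} {v : Fin n → Euc n} (hv : LinearIndependent ℝ v) :
    ∫ x in (genCone v : Set (Euc n)), Real.exp (-‖x‖ ^ 2) =
      |(Matrix.of fun i j => v j i : Matrix (Fin n) (Fin n) ℝ).det| *
        ∫ y in Set.Ici (0 : Fin n → ℝ), Real.exp (-‖∑ i, y i • v i‖ ^ 2) := by
  set V : Matrix (Fin n) (Fin n) ℝ := Matrix.of fun i j => v j i with hV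
  have hmul : ∀ y, WithLp.toLp 2 (V *ᵥ y) = ∑ i, y i • v i := by
    intro y
    ext k
    simp [hV, Matrix.mulVec, dotProduct, mul_comm]
  have hinj : Function.Injective fun y : Fin n → ℝ => V *ᵥ y := by
    intro y z hyz
    have h := congrArg (WithLp.toLp 2) hyz
    simp only [hmul] at h
    have hsub : ∑ i, (y i - z i) • v i = 0 := by
      simp only [sub_smul, Finset.sum_sub_distrib, h, sub_self]
    have := Fintype.linearIndependent_iff.1 hv _ hsub
    exact funext fun i => sub_eq_zero.1 (this i)
  have hpre : (WithLp.toLp 2) ⁻¹' (genCone v : Set (Euc n)) =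
      (fun y : Fin n → ℝ => V *ᵥ y) '' Set.Ici 0 := by
    ext x
    simp only [Set.mem_preimage, SetLike.mem_coe, mem_genCone_iff, Set.mem_image, Set.mem_Ici,
      Pi.le_def, Pi.zero_apply, ← hmul]
    exact exists_congr fun y => and_congr_right fun _ => (WithLp.toLp_injective 2).eq_iff
  rw [← (PiLp.volume_preserving_toLp (Fin n)).setIntegral_preimage_emb
    (MeasurableEquiv.toLp 2 _).measurableEmbedding, hpre]
  have hder : ∀ y ∈ Set.Ici (0 : Fin n → ℝ), HasFDerivWithinAt (fun y : Fin n → ℝ => V *ᵥ y)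
      (LinearMap.toContinuousLinearMap (Matrix.toLin' V)) (Set.Ici 0) y := fun y _ =>
    (LinearMap.toContinuousLinearMap (Matrix.toLin' V)).hasFDerivWithinAt
  rw [integral_image_eq_integral_abs_det_fderiv_smul volume measurableSet_Ici hder hinj.injOn]
  simp only [LinearMap.det_toContinuousLinearMap, LinearMap.det_toLin', smul_eq_mul, hmul]
  rw [integral_const_mul]

/-- Up to the factor `2 ^ n`, finite sums of the norms are integrals of finite sums of
`‖monomialTerm‖`, all bounded by the integral of one integrable majorant. -/
theorem summable_norm_seriesTerm {n : ℕ} {v : Fin n → Euc n} (hM : (assocMatrix v).PosDef)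
    (hint : ∀ a, IntegrableOn (monomialTerm v a) (Set.Ici 0)) :
    Summable fun a => ‖seriesTerm v a‖ := by
  have h : Summable fun a => ‖seriesTerm v a‖ / 2 ^ n := by
    refine summable_of_sum_le (c := ∫ y in Set.Ici (0 : Fin n → ℝ),
      Real.exp (-(y ⬝ᵥ (assocMatrix v *ᵥ y)))) (fun a => by positivity) fun s => ?_
    simp only [← integral_norm_monomialTerm]
    rw [← integral_finsetSum _ fun a _ => (hint a).norm]
    refine setIntegral_mono_on (integrable_finsetSum _ fun a _ => (hint a).norm)
      (integrable_exp_neg_quadratic hM).integrableOn measurableSet_Ici fun y hy => ?_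
    exact sum_norm_monomialTerm_le v hy s
  have := h.mul_right (2 ^ n)
  simpa using this

theorem integrableOn_monomialTerm {n : ℕ} {v : Fin n → Euc n} (hM : (assocMatrix v).PosDef)
    (a : IndexPair n → ℕ) : IntegrableOn (monomialTerm v a) (Set.Ici 0) := by
  refine Integrable.mono' (integrable_exp_neg_quadratic hM).integrableOn ?_ ?_
  · refine Continuous.aestronglyMeasurable ?_
    unfold monomialTerm
    fun_prop
  · refine (ae_restrict_iff' measurableSet_Ici).2 (Filter.Eventually.of_forall fun y hy => ?_)
    simpa using sum_norm_monomialTerm_le v hy {a}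

/-- The power series of a simplicial cone with positive definite associated matrix converges
absolutely, and its value is the normalized solid angle. -/
theorem solidAngle_genCone_eq_seriesValue {n : ℕ} {v : Fin n → Euc n} (hv : ∀ i, ‖v i‖ = 1)
    (hli : LinearIndependent ℝ v) (hM : (assocMatrix v).PosDef) :
    (Summable fun a : IndexPair n → ℕ => ‖seriesTerm v a‖) ∧
      solidAngle (genCone v : Set (Euc n)) = seriesValue v := by
  have hint := integrableOn_monomialTerm hM
  have hsum := summable_norm_seriesTerm hM hint
  refine ⟨hsum, ?_⟩
  have h := (hasSum_integral_of_summable_integral_norm hint (by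
    simp only [integral_norm_monomialTerm]
    exact hsum.div_const _)).tsum_eq
  simp only [integral_monomialTerm, (hasSum_monomialTerm hv _).tsum_eq, tsum_div_const] at h
  -- The factor `2 ^ n` collects the `1 / 2` that each half-line Gamma integral contributes.
  have h4 : (4 * Real.pi) ^ ((n : ℝ) / 2) = 2 ^ n * Real.pi ^ ((n : ℝ) / 2) := by
    rw [Real.mul_rpow (by norm_num) Real.pi_pos.le]
    congr 1
    rw [show (4 : ℝ) = 2 ^ (2 : ℝ) by norm_num, ← Real.rpow_mul (by norm_num),
      mul_div_cancel₀ _ (two_ne_zero), Real.rpow_natCast]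
  rw [solidAngle_eq_gaussian (measurableSet_of_fg (genCone_fg v)), setIntegral_genCone hli, ← h,
    seriesValue, h4]
  have hpi := (Real.rpow_pos_of_pos Real.pi_pos ((n : ℝ) / 2)).ne'
  field_simp

/-! ### Indicator identities for simplicial cones -/

section Coordinates

variable {n : ℕ}

theorem exists_sum_smul_eq {v : Fin n → Euc n} (hv : LinearIndependent ℝ v) (x : Euc n) :
    ∃ y : Fin n → ℝ, ∑ i, y i • v i = x := by
  have hspan : Submodule.span ℝ (Set.range v) = ⊤ :=
    hv.span_eq_top_of_card_eq_finrank' (by simp)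
  exact (Submodule.mem_span_range_iff_exists_fun ℝ).1 (hspan ▸ Submodule.mem_top)

theorem sum_smul_injective {d : ℕ} {v : Fin d → Euc n} (hv : LinearIndependent ℝ v)
    {y z : Fin d → ℝ} (h : ∑ i, y i • v i = ∑ i, z i • v i) : y = z := by
  have hsub : ∑ i, (y i - z i) • v i = 0 := by
    simp only [sub_smul, Finset.sum_sub_distrib, h, sub_self]
  exact funext fun i => sub_eq_zero.1 (Fintype.linearIndependent_iff.1 hv _ hsub i)

theorem sum_smul_mem_genCone_iff {d : ℕ} {v : Fin d → Euc n} (hv : LinearIndependent ℝ v)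
    (y : Fin d → ℝ) : ∑ i, y i • v i ∈ genCone v ↔ ∀ i, 0 ≤ y i := by
  rw [mem_genCone_iff]
  constructor
  · rintro ⟨z, hz, h⟩
    rwa [← sum_smul_injective hv h]
  · exact fun h => ⟨y, h, rfl⟩

theorem sum_add_single_smul {d : ℕ} (v : Fin d → Euc n) (y : Fin d → ℝ) (l : Fin d) (c : ℝ) :
    ∑ i, Function.update y l (y l + c) i • v i = ∑ i, y i • v i + c • v l := by
  have h : Function.update y l (y l + c) = y + Pi.single l c := by
    ext i
    by_cases hi : i = l
    · subst hi; simp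
    · simp [hi]
  simp [h, add_smul, Finset.sum_add_distrib, Pi.single_apply, ite_smul]

/-- The cone generated by the `vᵢ` and by `-v_m`. -/
def lineCone (v : Fin n → Euc n) (m : Fin n) : PointedCone ℝ (Euc n) :=
  genCone v ⊔ PointedCone.ofSubmodule (ℝ ∙ v m)

theorem sum_smul_mem_lineCone_iff {v : Fin n → Euc n} (hv : LinearIndependent ℝ v) (m : Fin n)
    (y : Fin n → ℝ) : ∑ i, y i • v i ∈ lineCone v m ↔ ∀ i, i ≠ m → 0 ≤ y i := by
  rw [lineCone, Submodule.mem_sup]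
  constructor
  · rintro ⟨a, ha, b, hb, h⟩ i hi
    obtain ⟨z, hz, rfl⟩ := mem_genCone_iff.1 ha
    obtain ⟨c, rfl⟩ := Submodule.mem_span_singleton.1 hb
    rw [← sum_add_single_smul] at h
    rw [← sum_smul_injective hv h, Function.update_of_ne hi]
    exact hz i
  · intro h
    refine ⟨_, (sum_smul_mem_genCone_iff hv (Function.update y m (y m + -y m))).2 fun i => ?_,
      y m • v m, Submodule.mem_span_singleton.2 ⟨_, rfl⟩, ?_⟩
    · by_cases hi : i = m
      · subst hi; simp
      · rw [Function.update_of_ne hi]; exact h i hi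
    · rw [sum_add_single_smul, neg_smul, neg_add_cancel_right]

theorem isConeWithLine_lineCone {v : Fin n → Euc n} (hv : LinearIndependent ℝ v) (m : Fin n) :
    IsConeWithLine (lineCone v m) := by
  have hle : ∀ c : ℝ, c • v m ∈ lineCone v m := fun c =>
    Submodule.mem_sup_right (Submodule.mem_span_singleton.2 ⟨c, rfl⟩)
  refine ⟨(genCone_fg v).sup (Submodule.FG.restrictScalars (IsNoetherian.noetherian _)),
    v m, hv.ne_zero m, ?_, ?_⟩
  · simpa using hle 1
  · simpa using hle (-1)

/-- Add `s` times the vector with index `l` to the vector with index `k`. -/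
def shear {d : ℕ} (v : Fin d → Euc n) (k l : Fin d) (s : ℝ) : Fin d → Euc n :=
  Function.update v k (v k + s • v l)

theorem shear_self {d : ℕ} (v : Fin d → Euc n) (k l : Fin d) (s : ℝ) :
    shear v k l s k = v k + s • v l := Function.update_self ..

theorem shear_of_ne {d : ℕ} (v : Fin d → Euc n) {k : Fin d} (l : Fin d) (s : ℝ) {i : Fin d}
    (hi : i ≠ k) : shear v k l s i = v i := Function.update_of_ne hi ..

theorem shear_shear_neg {d : ℕ} (v : Fin d → Euc n) {k l : Fin d} (hkl : k ≠ l) (s : ℝ) :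
    shear (shear v k l s) k l (-s) = v := by
  ext1 i
  by_cases hi : i = k
  · subst hi
    rw [shear_self, shear_self, shear_of_ne _ _ _ hkl.symm, neg_smul, add_neg_cancel_right]
  · rw [shear_of_ne _ _ _ hi, shear_of_ne _ _ _ hi]

theorem sum_smul_shear {d : ℕ} (v : Fin d → Euc n) (k l : Fin d) (s : ℝ) (y : Fin d → ℝ) :
    ∑ i, y i • shear v k l s i = ∑ i, y i • v i + (s * y k) • v l := by
  have h : shear v k l s = v + Pi.single k (s • v l) := by
    ext1 i
    by_cases hi : i = k
    · subst hi; simp [shear]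
    · simp [shear, hi]
  simp [h, smul_add, Finset.sum_add_distrib, Pi.single_apply, smul_smul, mul_comm]

theorem sum_smul_eq_shear {d : ℕ} (v : Fin d → Euc n) {k l : Fin d} (hkl : k ≠ l) (s : ℝ)
    (y : Fin d → ℝ) :
    ∑ i, y i • v i = ∑ i, Function.update y l (y l + -(s * y k)) i • shear v k l s i := by
  rw [sum_smul_shear, sum_add_single_smul, Function.update_of_ne hkl, neg_smul,
    neg_add_cancel_right]

theorem linearIndependent_shear {d : ℕ} {v : Fin d → Euc n} (hv : LinearIndependent ℝ v)
    {k l : Fin d} (hkl : k ≠ l) (s : ℝ) : LinearIndependent ℝ (shear v k l s) := by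
  rw [Fintype.linearIndependent_iff]
  intro g hg
  rw [sum_smul_shear, ← sum_add_single_smul] at hg
  have h := Fintype.linearIndependent_iff.1 hv _ hg
  have h' : ∀ i, i ≠ l → g i = 0 := fun i hi => by
    have := h i
    rwa [Function.update_of_ne hi] at this
  intro i
  by_cases hi : i = l
  · have := h l
    rw [Function.update_self, h' k hkl, mul_zero, add_zero] at this
    rw [hi, this]
  · exact h' i hi

theorem sum_smul_mem_genCone_shear_iff {d : ℕ} {v : Fin d → Euc n} (hv : LinearIndependent ℝ v)
    {k l : Fin d} (hkl : k ≠ l) (s : ℝ) (y : Fin d → ℝ) :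
    ∑ i, y i • v i ∈ genCone (shear v k l s) ↔
      (∀ i, i ≠ k → i ≠ l → 0 ≤ y i) ∧ 0 ≤ y k ∧ 0 ≤ y l - s * y k := by
  rw [sum_smul_eq_shear v hkl s, sum_smul_mem_genCone_iff (linearIndependent_shear hv hkl s)]
  constructor
  · intro h
    refine ⟨fun i hk hl => ?_, ?_, ?_⟩
    · simpa [hl] using h i
    · simpa [hkl] using h k
    · simpa [sub_eq_add_neg] using h l
  · rintro ⟨h, hk, hl⟩ i
    by_cases hil : i = l
    · subst hil; simpa [sub_eq_add_neg] using hl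
    · rw [Function.update_of_ne hil]
      by_cases hik : i = k
      · subst hik; exact hk
      · exact h i hik hil

theorem sum_smul_mem_genCone_iff_pair {d : ℕ} {v : Fin d → Euc n} (hv : LinearIndependent ℝ v)
    (k l : Fin d) (y : Fin d → ℝ) :
    ∑ i, y i • v i ∈ genCone v ↔
      (∀ i, i ≠ k → i ≠ l → 0 ≤ y i) ∧ 0 ≤ y k ∧ 0 ≤ y l := by
  rw [sum_smul_mem_genCone_iff hv]
  refine ⟨fun h => ⟨fun i _ _ => h i, h k, h l⟩, ?_⟩
  rintro ⟨h, hk, hl⟩ i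
  by_cases hik : i = k
  · exact hik ▸ hk
  by_cases hil : i = l
  · exact hil ▸ hl
  exact h i hik hil

/-- Replace the vector with index `l` by its negative. -/
def negAt {d : ℕ} (v : Fin d → Euc n) (l : Fin d) : Fin d → Euc n := Function.update v l (-v l)

theorem negAt_self {d : ℕ} (v : Fin d → Euc n) (l : Fin d) : negAt v l l = -v l :=
  Function.update_self ..

theorem negAt_of_ne {d : ℕ} (v : Fin d → Euc n) {l i : Fin d} (hi : i ≠ l) : negAt v l i = v i :=
  Function.update_of_ne hi ..

theorem negAt_negAt {d : ℕ} (v : Fin d → Euc n) (l : Fin d) : negAt (negAt v l) l = v := by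
  ext1 i
  by_cases hi : i = l
  · subst hi; rw [negAt_self, negAt_self, neg_neg]
  · rw [negAt_of_ne _ hi, negAt_of_ne _ hi]

theorem sum_smul_negAt {d : ℕ} (v : Fin d → Euc n) (l : Fin d) (y : Fin d → ℝ) :
    ∑ i, y i • negAt v l i = ∑ i, Function.update y l (-y l) i • v i := by
  refine Finset.sum_congr rfl fun i _ => ?_
  by_cases hi : i = l
  · subst hi; simp [negAt]
  · simp [negAt, hi]

theorem linearIndependent_negAt {d : ℕ} {v : Fin d → Euc n} (hv : LinearIndependent ℝ v)
    (l : Fin d) : LinearIndependent ℝ (negAt v l) := by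
  rw [Fintype.linearIndependent_iff]
  intro g hg i
  rw [sum_smul_negAt] at hg
  have h := Fintype.linearIndependent_iff.1 hv _ hg i
  by_cases hi : i = l
  · subst hi; simpa using h
  · simpa [hi] using h

theorem sum_smul_mem_genCone_negAt_shear_iff {d : ℕ} {v : Fin d → Euc n}
    (hv : LinearIndependent ℝ v) {k l : Fin d} (hkl : k ≠ l) (s : ℝ) (y : Fin d → ℝ) :
    ∑ i, y i • v i ∈ genCone (negAt (shear v k l s) l) ↔
      (∀ i, i ≠ k → i ≠ l → 0 ≤ y i) ∧ 0 ≤ y k ∧ 0 ≤ s * y k - y l := by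
  have h1 := linearIndependent_shear hv hkl s
  have h2 := linearIndependent_negAt h1 l
  rw [sum_smul_eq_shear v hkl s]
  set z := Function.update y l (y l + -(s * y k)) with hz
  have h3 : ∑ i, z i • shear v k l s i =
      ∑ i, Function.update z l (-z l) i • negAt (shear v k l s) l i := by
    rw [sum_smul_negAt]
    simp
  rw [h3, sum_smul_mem_genCone_iff_pair h2 k l]
  have hzk : Function.update z l (-z l) k = y k := by simp [hz, hkl]
  have hzl : Function.update z l (-z l) l = s * y k - y l := by simp [hz]; ring
  have hzi : ∀ i, i ≠ l → Function.update z l (-z l) i = y i := fun i hi => by simp [hz, hi]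
  rw [hzk, hzl]
  refine and_congr_left fun _ => forall_congr' fun i => forall_congr' fun _ =>
    forall_congr' fun hi => ?_
  rw [hzi i hi]

/-- The integer-valued indicator function of a cone. -/
noncomputable def coneIndicator (C : PointedCone ℝ (Euc n)) : Euc n → ℤ :=
  Set.indicator (C : Set (Euc n)) fun _ => 1

open Classical in
theorem coneIndicator_apply (C : PointedCone ℝ (Euc n)) (x : Euc n) :
    coneIndicator C x = if x ∈ C then 1 else 0 := by
  rw [coneIndicator, Set.indicator_apply]
  rfl

/-- Inclusion-exclusion in the coordinates `k`, `l`. The sheared cones are cut out by `yₗ ≥ 0` and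
by `yₖ ≥ 0` inside the half-plane `yₖ + t yₗ ≥ 0`. They intersect in the original cone, and their
union is the half-plane, which contains a line. The two new generators are opposite multiples of `vₗ
- t vₖ`. -/
theorem coneIndicator_genCone_of_pos {v : Fin n → Euc n} (hv : LinearIndependent ℝ v)
    {k l : Fin n} (hkl : k ≠ l) {t : ℝ} (ht : 0 < t) :
    coneIndicator (genCone v) = coneIndicator (genCone (shear v l k (-t))) +
      coneIndicator (genCone (shear v k l (-t⁻¹))) -
      coneIndicator (lineCone (shear v l k (-t)) l) := by
  classical
  rw [eq_sub_iff_add_eq]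
  ext x
  obtain ⟨y, rfl⟩ := exists_sum_smul_eq hv x
  simp only [Pi.add_apply, coneIndicator_apply]
  have h1 := sum_smul_mem_genCone_iff_pair hv k l y
  have h2 := sum_smul_mem_genCone_shear_iff hv hkl.symm (-t) y
  have h3 := sum_smul_mem_genCone_shear_iff hv hkl (-t⁻¹) y
  have h4 : ∑ i, y i • v i ∈ lineCone (shear v l k (-t)) l ↔
      (∀ i, i ≠ k → i ≠ l → 0 ≤ y i) ∧ 0 ≤ y k + t * y l := by
    rw [sum_smul_eq_shear v hkl.symm (-t),
      sum_smul_mem_lineCone_iff (linearIndependent_shear hv hkl.symm _)]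
    constructor
    · intro h
      refine ⟨fun i hik hil => by simpa [hik] using h i hil, by simpa using h k hkl⟩
    · rintro ⟨h, hk⟩ i hil
      by_cases hik : i = k
      · subst hik; simpa using hk
      · rw [Function.update_of_ne hik]; exact h i hik hil
  have h2' : ∑ i, y i • v i ∈ genCone (shear v l k (-t)) ↔
      (∀ i, i ≠ k → i ≠ l → 0 ≤ y i) ∧ 0 ≤ y l ∧ 0 ≤ y k + t * y l := by
    rw [h2, neg_mul, sub_neg_eq_add]
    exact and_congr_left fun _ => forall_congr' fun i => forall_comm
  have h3' : (0 ≤ y l - -t⁻¹ * y k) ↔ 0 ≤ y k + t * y l := by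
    rw [show y l - -t⁻¹ * y k = t⁻¹ * (y k + t * y l) by field_simp; ring]
    exact mul_nonneg_iff_of_pos_left (inv_pos.2 ht)
  rw [h3'] at h3
  -- The conditions on the other coordinates are common to all four cones; only a planar case check
  -- remains.
  generalize (∀ i, i ≠ k → i ≠ l → 0 ≤ y i) = P at h1 h2' h3 h4
  simp only [h1, h2', h3, h4]
  by_cases hP : P
  swap
  · simp [hP]
  simp only [hP, true_and]
  by_cases hk : 0 ≤ y k <;> by_cases hl : 0 ≤ y l <;> by_cases hp : 0 ≤ y k + t * y l <;>
    simp [hk, hl, hp]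
  · exact hp (by positivity)
  · push Not at hk hl
    nlinarith

/-- Here `vₗ + s vₖ` lies inside the cone. The original cone and `{yₖ ≥ 0, yₖ ≥ s yₗ}` intersect in
`{yₗ ≥ 0, yₖ ≥ s yₗ}`, and their union is the half-plane `yₖ ≥ 0`. -/
theorem coneIndicator_genCone_of_neg {v : Fin n → Euc n} (hv : LinearIndependent ℝ v)
    {k l : Fin n} (hkl : k ≠ l) {s : ℝ} (hs : 0 < s) :
    coneIndicator (genCone v) = coneIndicator (genCone (shear v l k s)) +
      coneIndicator (lineCone v l) -
      coneIndicator (genCone (negAt (shear v k l s⁻¹) l)) := by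
  classical
  rw [eq_sub_iff_add_eq]
  ext x
  obtain ⟨y, rfl⟩ := exists_sum_smul_eq hv x
  simp only [Pi.add_apply, coneIndicator_apply]
  have h1 := sum_smul_mem_genCone_iff_pair hv k l y
  have h2 := sum_smul_mem_genCone_shear_iff hv hkl.symm s y
  have h3 := sum_smul_mem_genCone_negAt_shear_iff hv hkl s⁻¹ y
  have h4 : ∑ i, y i • v i ∈ lineCone v l ↔ (∀ i, i ≠ k → i ≠ l → 0 ≤ y i) ∧ 0 ≤ y k := by
    rw [sum_smul_mem_lineCone_iff hv]
    constructor
    · exact fun h => ⟨fun i _ hil => h i hil, h k hkl⟩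
    · rintro ⟨h, hk⟩ i hil
      by_cases hik : i = k
      · exact hik ▸ hk
      · exact h i hik hil
  have h2' : ∑ i, y i • v i ∈ genCone (shear v l k s) ↔
      (∀ i, i ≠ k → i ≠ l → 0 ≤ y i) ∧ 0 ≤ y l ∧ 0 ≤ y k - s * y l := by
    rw [h2]
    exact and_congr_left fun _ => forall_congr' fun i => forall_comm
  have h3' : (0 ≤ s⁻¹ * y k - y l) ↔ 0 ≤ y k - s * y l := by
    rw [show s⁻¹ * y k - y l = s⁻¹ * (y k - s * y l) by field_simp]
    exact mul_nonneg_iff_of_pos_left (inv_pos.2 hs)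
  rw [h3'] at h3
  generalize (∀ i, i ≠ k → i ≠ l → 0 ≤ y i) = P at h1 h2' h3 h4
  simp only [h1, h2', h3, h4]
  by_cases hP : P
  swap
  · simp [hP]
  simp only [hP, true_and]
  by_cases hk : 0 ≤ y k <;> by_cases hl : 0 ≤ y l <;> by_cases hp : 0 ≤ y k - s * y l <;>
    simp only [hk, hl, hp] <;> norm_num
  all_goals nlinarith

end Coordinates

/-! ### Reduction to tridiagonal Gram matrices -/

section Reduction

variable {n : ℕ}

/-- The vectors `v` keep the last vector of `w` and the span of the others, and `vⱼ ⟂ v_l` whenever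
`j + 2 ≤ l` and `r ≤ l`. -/
structure IsPartialForm (w v : Fin n → Euc n) (r : ℕ) : Prop where
  linearIndependent : LinearIndependent ℝ v
  last_eq : ∀ i : Fin n, (i : ℕ) + 1 = n → v i = w i
  span_eq : Submodule.span ℝ (v '' {i | (i : ℕ) + 1 < n}) =
    Submodule.span ℝ (w '' {i | (i : ℕ) + 1 < n})
  orthogonal : ∀ j l : Fin n, (j : ℕ) + 2 ≤ l → r ≤ l → inner ℝ (v j) (v l) = 0

theorem IsPartialForm.refl {w : Fin n → Euc n} (hw : LinearIndependent ℝ w) :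
    IsPartialForm w w n where
  linearIndependent := hw
  last_eq _ _ := rfl
  span_eq := rfl
  orthogonal _ l _ h := absurd l.2 h.not_gt

/-- The vectors `v'` agree with `v` from the index `r` on, and the ones before `r` have the same
span. -/
structure IsHeadChange (r : ℕ) (v v' : Fin n → Euc n) : Prop where
  eq_of_le : ∀ i : Fin n, r ≤ i → v' i = v i
  span_eq : Submodule.span ℝ (v' '' {i | (i : ℕ) < r}) = Submodule.span ℝ (v '' {i | (i : ℕ) < r})

theorem IsHeadChange.trans {r : ℕ} {v v' v'' : Fin n → Euc n} (h : IsHeadChange r v v')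
    (h' : IsHeadChange r v' v'') : IsHeadChange r v v'' where
  eq_of_le i hi := (h'.eq_of_le i hi).trans (h.eq_of_le i hi)
  span_eq := h'.span_eq.trans h.span_eq

/-- Every `v l` with `l ≥ r + 1` is orthogonal to all vectors before `r`, hence to their span, hence
to whatever replaces them: orthogonality already achieved survives. -/
theorem IsPartialForm.of_isHeadChange {w v v' : Fin n → Euc n} {r : ℕ}
    (h : IsPartialForm w v (r + 1)) (hr : r < n) (hc : IsHeadChange r v v')
    (hv' : LinearIndependent ℝ v') : IsPartialForm w v' (r + 1) where
  linearIndependent := hv'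
  last_eq i hi := (hc.eq_of_le i (by omega)).trans (h.last_eq i hi)
  span_eq := by
    have hS : {i : Fin n | (i : ℕ) + 1 < n} =
        {i : Fin n | (i : ℕ) < r} ∪ {i : Fin n | r ≤ i ∧ (i : ℕ) + 1 < n} := by
      ext i
      simp only [Set.mem_ofPred_eq, Set.mem_union]
      omega
    rw [← h.span_eq, hS, Set.image_union, Set.image_union, Submodule.span_union,
      Submodule.span_union, hc.span_eq]
    congr 2
    exact Set.image_congr fun i hi => hc.eq_of_le i hi.1
  orthogonal j l hjl hl := by
    rw [hc.eq_of_le l (by omega)]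
    by_cases hj : r ≤ j
    · rw [hc.eq_of_le j hj]
      exact h.orthogonal j l hjl hl
    · have hmem : v' j ∈ Submodule.span ℝ (v '' {i | (i : ℕ) < r}) :=
        hc.span_eq ▸ Submodule.subset_span ⟨j, not_le.1 hj, rfl⟩
      have hle : Submodule.span ℝ (v '' {i | (i : ℕ) < r}) ≤ (ℝ ∙ v l)ᗮ := by
        rw [Submodule.span_le]
        rintro _ ⟨i, hi, rfl⟩
        have hi' : (i : ℕ) < r := hi
        exact Submodule.mem_orthogonal_singleton_iff_inner_left.2
          (h.orthogonal i l (by omega) hl)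
      exact Submodule.mem_orthogonal_singleton_iff_inner_left.1 (hle hmem)

theorem span_shear_le {v : Fin n → Euc n} {k l : Fin n} (s : ℝ) {S : Set (Fin n)} (hk : k ∈ S)
    (hl : l ∈ S) : Submodule.span ℝ (shear v k l s '' S) ≤ Submodule.span ℝ (v '' S) := by
  rw [Submodule.span_le]
  rintro _ ⟨i, hi, rfl⟩
  by_cases hik : i = k
  · subst hik
    rw [shear_self]
    exact add_mem (Submodule.subset_span ⟨i, hk, rfl⟩)
      (Submodule.smul_mem _ _ (Submodule.subset_span ⟨l, hl, rfl⟩))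
  · rw [shear_of_ne _ _ _ hik]
    exact Submodule.subset_span ⟨i, hi, rfl⟩

theorem isHeadChange_shear (v : Fin n → Euc n) {k l : Fin n} (hkl : k ≠ l) (s : ℝ) {r : ℕ}
    (hk : (k : ℕ) < r) (hl : (l : ℕ) < r) : IsHeadChange r v (shear v k l s) where
  eq_of_le i hi := shear_of_ne _ _ _ (by rintro rfl; omega)
  span_eq := by
    refine le_antisymm (span_shear_le s hk hl) ?_
    have h := span_shear_le (v := shear v k l s) (-s) (S := {i | (i : ℕ) < r}) hk hl
    rwa [shear_shear_neg v hkl] at h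

theorem span_negAt_le {v : Fin n → Euc n} (l : Fin n) (S : Set (Fin n)) :
    Submodule.span ℝ (negAt v l '' S) ≤ Submodule.span ℝ (v '' S) := by
  rw [Submodule.span_le]
  rintro _ ⟨i, hi, rfl⟩
  by_cases hil : i = l
  · subst hil
    rw [negAt_self]
    exact neg_mem (Submodule.subset_span ⟨i, hi, rfl⟩)
  · rw [negAt_of_ne _ hil]
    exact Submodule.subset_span ⟨i, hi, rfl⟩

theorem isHeadChange_negAt (v : Fin n → Euc n) {l : Fin n} {r : ℕ} (hl : (l : ℕ) < r) :
    IsHeadChange r v (negAt v l) where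
  eq_of_le i hi := negAt_of_ne _ (by rintro rfl; omega)
  span_eq := by
    refine le_antisymm (span_negAt_le l _) ?_
    have h := span_negAt_le (v := negAt v l) l {i | (i : ℕ) < r}
    rwa [negAt_negAt] at h

theorem isHeadChange_swap (v : Fin n → Euc n) {k l : Fin n} {r : ℕ} (hk : (k : ℕ) < r)
    (hl : (l : ℕ) < r) : IsHeadChange r v (v ∘ Equiv.swap k l) where
  eq_of_le i hi := by
    rw [Function.comp_apply, Equiv.swap_apply_of_ne_of_ne] <;> (rintro rfl; omega)
  span_eq := by
    rw [Set.image_comp]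
    congr 2
    ext i
    rw [Equiv.image_eq_preimage_symm, Equiv.symm_swap, Set.mem_preimage, Equiv.swap_apply_def]
    split_ifs with h1 h2
    · subst h1; exact ⟨fun _ => hk, fun _ => hl⟩
    · subst h2; exact ⟨fun _ => hl, fun _ => hk⟩
    · rfl

theorem genCone_comp_equiv {d : ℕ} (v : Fin d → Euc n) (e : Equiv.Perm (Fin d)) :
    genCone (v ∘ e) = genCone v := by
  rw [genCone, genCone, e.surjective.range_comp]

/-- The indices before `r` of the vectors that are not orthogonal to the vector with index `r`. -/
noncomputable def badIndices (v : Fin n → Euc n) (r : Fin n) : Finset (Fin n) :=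
  Finset.univ.filter fun j => j < r ∧ inner ℝ (v j) (v r) ≠ 0

theorem mem_badIndices {v : Fin n → Euc n} {r j : Fin n} :
    j ∈ badIndices v r ↔ j < r ∧ inner ℝ (v j) (v r) ≠ 0 := by
  simp [badIndices]

theorem badIndices_shear_ssubset {v : Fin n → Euc n} {r k l : Fin n} {s : ℝ}
    (hk : k ∈ badIndices v r) (h : inner ℝ (v k) (v r) + s * inner ℝ (v l) (v r) = 0) :
    badIndices (shear v k l s) r ⊂ badIndices v r := by
  have hkr := (mem_badIndices.1 hk).1
  have hr : shear v k l s r = v r := shear_of_ne _ _ _ hkr.ne'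
  have hz : inner ℝ (shear v k l s k) (v r) = 0 := by
    rw [shear_self, inner_add_left, real_inner_smul_left, h]
  refine (Finset.ssubset_iff_of_subset fun j hj => ?_).2 ⟨k, hk, fun hk' => ?_⟩
  · obtain ⟨hjr, hj⟩ := mem_badIndices.1 hj
    rw [hr] at hj
    have hjk : j ≠ k := by
      rintro rfl
      exact hj hz
    rw [shear_of_ne _ _ _ hjk] at hj
    exact mem_badIndices.2 ⟨hjr, hj⟩
  · have := (mem_badIndices.1 hk').2
    rw [hr] at this
    exact this hz

theorem badIndices_negAt (v : Fin n → Euc n) {r l : Fin n} (hl : l < r) :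
    badIndices (negAt v l) r = badIndices v r := by
  ext j
  rw [mem_badIndices, mem_badIndices, negAt_of_ne v hl.ne']
  by_cases hj : j = l
  · subst hj; rw [negAt_self, inner_neg_left, neg_ne_zero]
  · rw [negAt_of_ne v hj]

/-- Induction on the set of bad indices. Two bad indices allow a splitting whose simplicial pieces
have fewer; a single one is harmless once it is moved to position `r - 1`, where orthogonality to `v
r` is not required. -/
theorem coneIndicator_mem_of_partialForm_succ {w : Fin n → Euc n} {G : AddSubgroup (Euc n → ℤ)}
    (hline : ∀ (v : Fin n → Euc n) (m : Fin n), LinearIndependent ℝ v →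
      coneIndicator (lineCone v m) ∈ G) (r : Fin n)
    (hG : ∀ v, IsPartialForm w v r → coneIndicator (genCone v) ∈ G) :
    ∀ v, IsPartialForm w v (r + 1) → coneIndicator (genCone v) ∈ G := by
  suffices H : ∀ (T : Finset (Fin n)) (v : Fin n → Euc n), badIndices v r = T →
      IsPartialForm w v (r + 1) → coneIndicator (genCone v) ∈ G from
    fun v hv => H _ v rfl hv
  intro T
  induction T using Finset.strongInduction with
  | H T ih =>
  rintro v rfl hv
  have step : ∀ v', badIndices v' r ⊂ badIndices v r → IsHeadChange r v v' →
      LinearIndependent ℝ v' → coneIndicator (genCone v') ∈ G := fun v' hs hc hli =>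
    ih _ hs v' rfl (hv.of_isHeadChange r.2 hc hli)
  have hli := hv.linearIndependent
  by_cases hT : ∃ k ∈ badIndices v r, ∃ l ∈ badIndices v r, k ≠ l
  · obtain ⟨k, hk, l, hl, hkl⟩ := hT
    obtain ⟨hkr, hck⟩ := mem_badIndices.1 hk
    obtain ⟨hlr, hcl⟩ := mem_badIndices.1 hl
    have hkr' : (k : ℕ) < r := hkr
    have hlr' : (l : ℕ) < r := hlr
    -- With this ratio both `vₗ - t vₖ` and `vₖ - t⁻¹ vₗ` are orthogonal to `v r`; the sign of `t`
    -- decides which identity applies.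
    set t := inner ℝ (v l) (v r) / inner ℝ (v k) (v r) with ht
    have ht0 : t ≠ 0 := div_ne_zero hcl hck
    have hmul : inner ℝ (v l) (v r) = t * inner ℝ (v k) (v r) := by
      rw [ht, div_mul_cancel₀ _ hck]
    have hA : coneIndicator (genCone (shear v l k (-t))) ∈ G :=
      step _ (badIndices_shear_ssubset hl (by rw [hmul]; ring))
        (isHeadChange_shear v hkl.symm _ hlr' hkr') (linearIndependent_shear hli hkl.symm _)
    have hss : badIndices (shear v k l (-t⁻¹)) r ⊂ badIndices v r :=
      badIndices_shear_ssubset hk (by rw [hmul]; field_simp; ring)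
    have hcB := isHeadChange_shear v hkl (-t⁻¹) hkr' hlr'
    have hliB := linearIndependent_shear hli hkl (-t⁻¹)
    rcases lt_or_gt_of_ne ht0 with hneg | hpos
    · have hid := coneIndicator_genCone_of_neg hli hkl (neg_pos.2 hneg)
      rw [inv_neg] at hid
      rw [hid]
      refine sub_mem (add_mem hA (hline v l hli)) (step _ ?_ (hcB.trans (isHeadChange_negAt _ hlr'))
        (linearIndependent_negAt hliB l))
      rwa [badIndices_negAt _ hlr]
    · rw [coneIndicator_genCone_of_pos hli hkl hpos]
      exact sub_mem (add_mem hA (step _ hss hcB hliB))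
        (hline _ l (linearIndependent_shear hli hkl.symm _))
  · push Not at hT
    have key : ∀ v', IsPartialForm w v' (r + 1) →
        (∀ j : Fin n, (j : ℕ) + 2 ≤ r → inner ℝ (v' j) (v' r) = 0) → IsPartialForm w v' r := by
      intro v' hv' ho
      refine ⟨hv'.linearIndependent, hv'.last_eq, hv'.span_eq, fun j l hjl hrl => ?_⟩
      rcases hrl.eq_or_lt with h | h
      · obtain rfl : r = l := Fin.ext h
        exact ho j hjl
      · exact hv'.orthogonal j l hjl h
    rcases (badIndices v r).eq_empty_or_nonempty with hE | ⟨m, hm⟩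
    · refine hG v (key v hv fun j hj => ?_)
      by_contra hne
      have : j ∈ badIndices v r := mem_badIndices.2 ⟨Fin.lt_def.2 (by omega), hne⟩
      simp [hE] at this
    · have hmr : (m : ℕ) < r := (mem_badIndices.1 hm).1
      let p : Fin n := ⟨r - 1, by omega⟩
      have hp : (p : ℕ) + 1 = r := by simp only [p]; omega
      have hc := isHeadChange_swap v (k := m) (l := p) hmr (by omega : (p : ℕ) < r)
      rw [← genCone_comp_equiv v (Equiv.swap m p)]
      refine hG _ (key _ (hv.of_isHeadChange r.2 hc (hli.comp _ (Equiv.injective _)))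
        fun j hj => ?_)
      rw [hc.eq_of_le r le_rfl, Function.comp_apply]
      by_contra hne
      have hlt : Equiv.swap m p j < r := by
        rw [Equiv.swap_apply_def]
        split_ifs
        · exact Fin.lt_def.2 (by omega)
        · exact hmr
        · exact Fin.lt_def.2 (by omega)
      -- The preimage of a bad index under the swap must be `p`, contradicting `j + 2 ≤ r`.
      have h1 := hT _ (mem_badIndices.2 ⟨hlt, hne⟩) m hm
      have h2 : j = p := by
        rw [← (Equiv.swap m p).injective.eq_iff, h1, Equiv.swap_apply_right]
      rw [h2] at hj
      omega

theorem coneIndicator_genCone_mem {w : Fin n → Euc n} (hw : LinearIndependent ℝ w)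
    {G : AddSubgroup (Euc n → ℤ)}
    (hline : ∀ (v : Fin n → Euc n) (m : Fin n), LinearIndependent ℝ v →
      coneIndicator (lineCone v m) ∈ G)
    (hG : ∀ v, IsPartialForm w v 0 → coneIndicator (genCone v) ∈ G) :
    coneIndicator (genCone w) ∈ G := by
  -- At `r = n` the orthogonality condition is empty, so `w` itself qualifies; each step lowers `r`
  -- by one.
  have H : ∀ r, r ≤ n → ∀ v, IsPartialForm w v r → coneIndicator (genCone v) ∈ G := by
    intro r
    induction r with
    | zero => exact fun _ => hG
    | succ r ih =>
      intro hr
      exact coneIndicator_mem_of_partialForm_succ hline ⟨r, hr⟩ (ih (Nat.le_of_succ_le hr))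
  exact H n le_rfl w (IsPartialForm.refl hw)

theorem genCone_smul_of_pos {d : ℕ} (v : Fin d → Euc n) {c : Fin d → ℝ} (hc : ∀ i, 0 < c i) :
    genCone (fun i => c i • v i) = genCone v := by
  ext x
  rw [mem_genCone_iff, mem_genCone_iff]
  constructor
  · rintro ⟨y, hy, rfl⟩
    exact ⟨fun i => y i * c i, fun i => mul_nonneg (hy i) (hc i).le, by simp [smul_smul]⟩
  · rintro ⟨y, hy, rfl⟩
    refine ⟨fun i => y i / c i, fun i => div_nonneg (hy i) (hc i).le, ?_⟩
    simp [smul_smul, (hc _).ne']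

theorem linearIndependent_smul_of_ne_zero {d : ℕ} {v : Fin d → Euc n}
    (hv : LinearIndependent ℝ v) {c : Fin d → ℝ} (hc : ∀ i, c i ≠ 0) :
    LinearIndependent ℝ fun i => c i • v i :=
  hv.units_smul fun i => Units.mk0 (c i) (hc i)

/-- A simplicial cone is generated by linearly independent unit vectors. -/
theorem exists_unit_generators {d : ℕ} {v : Fin d → Euc n} (hv : LinearIndependent ℝ v) :
    ∃ u : Fin d → Euc n, (∀ i, ‖u i‖ = 1) ∧ LinearIndependent ℝ u ∧ genCone u = genCone v :=
  have hpos : ∀ i, 0 < ‖v i‖⁻¹ := fun i => inv_pos.2 (norm_pos_iff.2 (hv.ne_zero i))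
  ⟨fun i => ‖v i‖⁻¹ • v i, fun i => norm_smul_inv_norm (𝕜 := ℝ) (hv.ne_zero i),
    linearIndependent_smul_of_ne_zero hv fun i => (hpos i).ne', genCone_smul_of_pos v hpos⟩

/-- Only products of consecutive signs are prescribed, so the signs can be chosen recursively; a
cyclic pattern of nonzero entries could obstruct this. -/
theorem exists_signs (a : ℕ → ℝ) :
    ∃ ε : ℕ → ℤˣ, ∀ j, ((ε j : ℤ) : ℝ) * ((ε (j + 1) : ℤ) : ℝ) * a j = -|a j| := by
  obtain ⟨ε, hs⟩ : ∃ ε : ℕ → ℤˣ, ∀ j, ε (j + 1) = if 0 ≤ a j then -ε j else ε j :=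
    ⟨fun j => Nat.rec 1 (fun j e => if 0 ≤ a j then -e else e) j, fun _ => rfl⟩
  refine ⟨ε, fun j => ?_⟩
  rw [hs]
  have hsq : ((ε j : ℤ) : ℝ) * ((ε j : ℤ) : ℝ) = 1 := by
    rcases Int.units_eq_one_or (ε j) with h | h <;> simp [h]
  split_ifs with h
  · rw [abs_of_nonneg h]
    push_cast
    linear_combination (-a j) * hsq
  · rw [abs_of_neg (not_le.1 h)]
    linear_combination (a j) * hsq

theorem exists_signs_quadratic {v : Fin n → Euc n} (hv : ∀ i, ‖v i‖ = 1)
    (ho : ∀ j l : Fin n, (j : ℕ) + 2 ≤ l → inner ℝ (v j) (v l) = 0) :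
    ∃ ε : Fin n → ℤˣ, ∀ x : Fin n → ℝ,
      x ⬝ᵥ (assocMatrix v *ᵥ x) = ‖∑ i, (((ε i : ℤ) : ℝ) * x i) • v i‖ ^ 2 := by
  obtain ⟨ε, hε⟩ := exists_signs fun j =>
    if h : j + 1 < n then inner ℝ (v ⟨j, Nat.lt_of_succ_lt h⟩) (v ⟨j + 1, h⟩) else 0
  refine ⟨fun i => ε i, fun x => ?_⟩
  rw [norm_sq_sum_smul_of_unit hv, dotProduct_assocMatrix_mulVec, sub_eq_add_neg, ← mul_neg,
    ← Finset.sum_neg_distrib]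
  congr 1
  · refine Finset.sum_congr rfl fun i _ => ?_
    rcases Int.units_eq_one_or (ε i) with h | h <;> simp [h]
  · congr 1
    refine Finset.sum_congr rfl fun p _ => ?_
    obtain ⟨⟨i, j⟩, hij⟩ := p
    have hij' : (i : ℕ) < j := hij
    simp only
    by_cases h2 : (i : ℕ) + 2 ≤ j
    · simp [ho i j h2]
    · have hj : (i : ℕ) + 1 = j := by omega
      have h := hε i
      have hlt : (i : ℕ) + 1 < n := hj ▸ j.2
      obtain rfl : j = ⟨i + 1, hlt⟩ := Fin.ext hj.symm
      rw [dif_pos hlt] at h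
      simp only [Fin.eta] at h
      linear_combination (-(x i * x ⟨i + 1, hlt⟩)) * h

/-- The form is the squared norm of a combination of independent vectors, so it vanishes only at
`0`. -/
theorem posDef_of_quadratic {v : Fin n → Euc n} (hv : LinearIndependent ℝ v) {ε : Fin n → ℤˣ}
    (hε : ∀ x : Fin n → ℝ,
      x ⬝ᵥ (assocMatrix v *ᵥ x) = ‖∑ i, (((ε i : ℤ) : ℝ) * x i) • v i‖ ^ 2) :
    (assocMatrix v).PosDef := by
  refine Matrix.PosDef.of_dotProduct_mulVec_pos ?_ fun x hx => ?_
  · ext i j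
    simp only [assocMatrix, Matrix.conjTranspose_apply, Matrix.of_apply, star_trivial,
      real_inner_comm (v i), eq_comm (a := i)]
  · rw [star_trivial, hε]
    refine pow_pos (norm_pos_iff.2 fun h => hx ?_) 2
    ext i
    have := Fintype.linearIndependent_iff.1 hv _ h i
    have hne : ((ε i : ℤ) : ℝ) ≠ 0 := Int.cast_ne_zero.2 (Units.ne_zero _)
    exact (mul_eq_zero.1 this).resolve_left hne

theorem IsPartialForm.exists_isDefiniteForm {w v : Fin n → Euc n} (hw : ∀ i, ‖w i‖ = 1)
    (h : IsPartialForm w v 0) : ∃ u, IsDefiniteForm w u ∧ genCone u = genCone v := by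
  have hv := h.linearIndependent
  have hpos : ∀ i, 0 < ‖v i‖⁻¹ := fun i => inv_pos.2 (norm_pos_iff.2 (hv.ne_zero i))
  set u : Fin n → Euc n := fun i => ‖v i‖⁻¹ • v i with hu
  have hunit : ∀ i, ‖u i‖ = 1 := fun i => norm_smul_inv_norm (𝕜 := ℝ) (hv.ne_zero i)
  have hli : LinearIndependent ℝ u :=
    linearIndependent_smul_of_ne_zero hv fun i => (hpos i).ne'
  have ho : ∀ j l : Fin n, (j : ℕ) + 2 ≤ l → inner ℝ (u j) (u l) = 0 := fun j l hjl => by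
    rw [hu, real_inner_smul_left, real_inner_smul_right, h.orthogonal j l hjl (Nat.zero_le _),
      mul_zero, mul_zero]
  obtain ⟨ε, hε⟩ := exists_signs_quadratic hunit ho
  refine ⟨u, ⟨hli, posDef_of_quadratic hli hε, hunit, fun i hi => ?_, ?_, fun i j hi hj =>
    ho i j (by omega), ε, hε⟩, genCone_smul_of_pos v hpos⟩
  · rw [hu]
    simp only
    rw [h.last_eq i hi, hw, inv_one, one_smul]
  · rw [← h.span_eq]
    refine le_antisymm (Submodule.span_le.2 ?_) (Submodule.span_le.2 ?_)
    · rintro _ ⟨i, hi, rfl⟩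
      exact Submodule.smul_mem _ _ (Submodule.subset_span ⟨i, hi, rfl⟩)
    · rintro _ ⟨i, hi, rfl⟩
      have : v i = ‖v i‖ • u i := by
        rw [hu]
        simp only
        rw [smul_smul, mul_inv_cancel₀ (norm_ne_zero_iff.2 (hv.ne_zero i)), one_smul]
      rw [this]
      exact Submodule.smul_mem _ _ (Submodule.subset_span ⟨i, hi, rfl⟩)

/-- Lets the reduction work with membership in a subgroup of functions, extracting explicit pieces
and signs only at the end. -/
theorem exists_signed_sum_of_mem_closure {P : PointedCone ℝ (Euc n) → Prop} {f : Euc n → ℤ}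
    (hf : f ∈ AddSubgroup.closure {g | ∃ C, P C ∧ g = coneIndicator C}) :
    ∃ (N : ℕ) (s : Fin N → ℤˣ) (C : Fin N → PointedCone ℝ (Euc n)), (∀ i, P (C i)) ∧
      ∀ x, f x = ∑ i, (s i : ℤ) * coneIndicator (C i) x := by
  induction hf using AddSubgroup.closure_induction with
  | mem g hg =>
    obtain ⟨C, hC, rfl⟩ := hg
    exact ⟨1, fun _ => 1, fun _ => C, fun _ => hC, fun x => by simp⟩
  | zero => exact ⟨0, Fin.elim0, Fin.elim0, fun i => i.elim0, fun x => by simp⟩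
  | add f g _ _ hf hg =>
    obtain ⟨N, s, C, hC, h⟩ := hf
    obtain ⟨N', s', C', hC', h'⟩ := hg
    refine ⟨N + N', Fin.append s s', Fin.append C C', fun i => ?_, fun x => ?_⟩
    · induction i using Fin.addCases with
      | left i => rw [Fin.append_left]; exact hC i
      | right i => rw [Fin.append_right]; exact hC' i
    · rw [Pi.add_apply, h, h', Fin.sum_univ_add]
      simp
  | neg f _ hf =>
    obtain ⟨N, s, C, hC, h⟩ := hf
    exact ⟨N, fun i => -s i, C, hC, fun x => by simp [h]⟩

end Reduction

/-! ### Soundness and completeness of the recursive procedure -/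

theorem ComputesTo.fg {n : ℕ} {C : PointedCone ℝ (Euc n)} {t : ℝ} (h : ComputesTo n C t) :
    C.FG := by
  induction h with
  | series v _ _ _ _ => exact genCone_fg v
  | reduce _ φ _ _ _ ih => exact orthSumCone_fg φ ih
  | decompose w _ _ _ _ _ _ _ _ => exact genCone_fg w

theorem IsFirstDecomposition.fg {n N : ℕ} {w : Fin n → Euc n} {s : Fin N → ℤˣ}
    {C : Fin N → PointedCone ℝ (Euc n)} (h : IsFirstDecomposition w s C) (i : Fin N) :
    (C i).FG := by
  rcases h.forms i with h | ⟨v, _, h⟩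
  · exact h.1
  · exact h ▸ genCone_fg v

/-- The normalized solid angle is additive over signed decompositions. -/
theorem solidAngle_eq_sum {n N : ℕ} {K : PointedCone ℝ (Euc n)}
    (hK : MeasurableSet (K : Set (Euc n))) {s : Fin N → ℤˣ} {C : Fin N → PointedCone ℝ (Euc n)}
    (hC : ∀ i, MeasurableSet (C i : Set (Euc n)))
    (h : ∀ x, coneIndicator K x = ∑ i, (s i : ℤ) * coneIndicator (C i) x) :
    solidAngle (K : Set (Euc n)) =
      ∑ i, ((s i : ℤ) : ℝ) * solidAngle (C i : Set (Euc n)) := by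
  have hint : ∀ {D : PointedCone ℝ (Euc n)}, MeasurableSet (D : Set (Euc n)) →
      solidAngle (D : Set (Euc n)) =
        ∫ x, ((coneIndicator D x : ℤ) : ℝ) ∂gaussianMeasure n := by
    intro D hD
    rw [solidAngle_eq_gaussianMeasure hD, ← integral_indicator_one hD]
    refine integral_congr_ae (Filter.Eventually.of_forall fun x => ?_)
    by_cases hx : x ∈ (D : Set (Euc n)) <;> simp [coneIndicator, hx]
  have hintegrable : ∀ i, Integrable (fun x => ((coneIndicator (C i) x : ℤ) : ℝ))
      (gaussianMeasure n) := by
    intro i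
    refine ((integrable_const (1 : ℝ)).indicator (hC i)).congr
      (Filter.Eventually.of_forall fun x => ?_)
    by_cases hx : x ∈ (C i : Set (Euc n)) <;> simp [coneIndicator, hx]
  rw [hint hK]
  simp only [h, Int.cast_sum, Int.cast_mul]
  rw [integral_finsetSum _ fun i _ => (hintegrable i).const_mul _]
  refine Finset.sum_congr rfl fun i _ => ?_
  rw [integral_const_mul, hint (hC i)]

theorem IsFirstDecomposition.solidAngle_eq {n N : ℕ} {w : Fin n → Euc n} {s : Fin N → ℤˣ}
    {C : Fin N → PointedCone ℝ (Euc n)} (h : IsFirstDecomposition w s C) :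
    solidAngle (genCone w : Set (Euc n)) =
      ∑ i, ((s i : ℤ) : ℝ) * solidAngle (C i : Set (Euc n)) :=
  solidAngle_eq_sum (measurableSet_of_fg (genCone_fg w)) (fun i => measurableSet_of_fg (h.fg i))
    h.indicator_eq

/-- Every value that the recursive procedure assigns to a cone is its normalized solid angle. -/
theorem ComputesTo.eq_solidAngle {n : ℕ} {C : PointedCone ℝ (Euc n)} {t : ℝ}
    (h : ComputesTo n C t) : t = solidAngle (C : Set (Euc n)) := by
  induction h with
  | series v hv hli hM _ => exact (solidAngle_genCone_eq_seriesValue hv hli hM).2.symm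
  | reduce _ φ _ _ h ih => rw [ih, solidAngle_orthSumCone φ (measurableSet_of_fg h.fg)]
  | decompose w _ _ s C dec t _ ih =>
    rw [dec.solidAngle_eq]
    exact Finset.sum_congr rfl fun i _ => by rw [ih i]

/-- The projection along `v p` kills exactly that line, so the other generators stay independent and
the base is again simplicial. This keeps the induction on the dimension within simplicial cones,
with no triangulation of general polyhedral ones. -/
theorem lineCone_eq_orthSumCone {m : ℕ} {v : Fin (m + 1) → Euc (m + 1)}
    (hv : LinearIndependent ℝ v) (p : Fin (m + 1)) :
    ∃ (φ : Euc m →ₗᵢ[ℝ] Euc (m + 1)) (u : Fin m → Euc m), (∀ i, ‖u i‖ = 1) ∧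
      LinearIndependent ℝ u ∧ lineCone v p = orthSumCone φ (genCone u) := by
  obtain ⟨φ, hφ⟩ := exists_linearIsometry_range_eq (hv.ne_zero p)
  set ψ := φ.toContinuousLinearMap.adjoint with hψ
  have hker : ∀ x, ψ x = 0 ↔ ∃ c : ℝ, c • v p = x := by
    intro x
    rw [hψ, adjoint_eq_zero_iff, hφ, Submodule.orthogonal_orthogonal,
      Submodule.mem_span_singleton]
  have hp : ψ (v p) = 0 := (hker _).2 ⟨1, one_smul _ _⟩
  have hmap : ∀ y : Fin (m + 1) → ℝ, ψ (∑ i, y i • v i) =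
      ∑ j, y (p.succAbove j) • ψ (v (p.succAbove j)) := by
    intro y
    rw [Fin.sum_univ_succAbove _ p, map_add, map_smul, hp, smul_zero, zero_add, map_sum]
    simp only [map_smul]
  have hli : LinearIndependent ℝ fun j => ψ (v (p.succAbove j)) := by
    rw [Fintype.linearIndependent_iff]
    intro g hg j
    -- A relation among the projections lifts, with coefficient `0` at `p`, to a vector on the line
    -- of `v p`; comparing coordinates makes every `g j` vanish.
    have h0 : ψ (∑ i, (p.insertNth 0 g : Fin (m + 1) → ℝ) i • v i) = 0 := by
      rw [hmap]
      simpa using hg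
    obtain ⟨c, hc⟩ := (hker _).1 h0
    have hc' : ∑ i, (Pi.single p c : Fin (m + 1) → ℝ) i • v i = c • v p := by
      simp [Pi.single_apply, ite_smul]
    have := congrFun (sum_smul_injective hv (hc'.trans hc)) (p.succAbove j)
    simpa [Fin.succAbove_ne] using this.symm
  obtain ⟨u, hu, hu', hgen⟩ := exists_unit_generators hli
  refine ⟨φ, u, hu, hu', ?_⟩
  ext x
  obtain ⟨y, rfl⟩ := exists_sum_smul_eq hv x
  rw [mem_orthSumCone_iff, ← hψ, hgen, hmap, sum_smul_mem_lineCone_iff hv,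
    sum_smul_mem_genCone_iff hli fun j => y (p.succAbove j)]
  constructor
  · exact fun h j => h _ (Fin.succAbove_ne p j)
  · intro h i hi
    obtain ⟨j, rfl⟩ := Fin.exists_succAbove_eq hi
    exact h j

/-- A decomposition of the first kind into cones with lines over simplicial cones and simplicial
cones with tridiagonal Gram matrix. -/
theorem exists_firstDecomposition_lineCone {n : ℕ} {w : Fin n → Euc n} (hw_norm : ∀ i, ‖w i‖ = 1)
    (hw : LinearIndependent ℝ w) :
    ∃ (N : ℕ) (s : Fin N → ℤˣ) (C : Fin N → PointedCone ℝ (Euc n)),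
      IsFirstDecomposition w s C ∧
        ∀ i, (∃ (v : Fin n → Euc n) (m : Fin n), LinearIndependent ℝ v ∧ C i = lineCone v m) ∨
          ∃ v : Fin n → Euc n, IsDefiniteForm w v ∧ C i = genCone v := by
  obtain ⟨N, s, C, hC, h⟩ := exists_signed_sum_of_mem_closure (f := coneIndicator (genCone w))
    (P := fun C => (∃ (v : Fin n → Euc n) (m : Fin n), LinearIndependent ℝ v ∧ C = lineCone v m) ∨
          ∃ v : Fin n → Euc n, IsDefiniteForm w v ∧ C = genCone v)
    (coneIndicator_genCone_mem hw
      (fun v m hv => AddSubgroup.subset_closure ⟨_, Or.inl ⟨v, m, hv, rfl⟩, rfl⟩)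
      fun v hv => by
        obtain ⟨u, hu, hgen⟩ := hv.exists_isDefiniteForm hw_norm
        exact AddSubgroup.subset_closure ⟨_, Or.inr ⟨u, hu, rfl⟩, by rw [hgen]⟩)
  refine ⟨N, s, C, ⟨h, fun i => ?_⟩, hC⟩
  rcases hC i with ⟨v, m, hv, hCi⟩ | h
  · exact Or.inl (hCi ▸ isConeWithLine_lineCone hv m)
  · exact Or.inr h

theorem IsDefiniteForm.summable_and_solidAngle_eq {n : ℕ} {w v : Fin n → Euc n}
    (h : IsDefiniteForm w v) : (Summable fun a : IndexPair n → ℕ => ‖seriesTerm v a‖) ∧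
      solidAngle (genCone v : Set (Euc n)) = seriesValue v :=
  solidAngle_genCone_eq_seriesValue h.norm_eq_one h.linearIndependent h.posDef

theorem computesTo_of_forms {n : ℕ} {w : Fin n → Euc n} {C : PointedCone ℝ (Euc n)}
    (ih : ∀ m < n, ∀ u : Fin m → Euc m, (∀ i, ‖u i‖ = 1) → LinearIndependent ℝ u →
      ComputesTo m (genCone u) (solidAngle (genCone u : Set (Euc m))))
    (hC : (∃ (v : Fin n → Euc n) (m : Fin n), LinearIndependent ℝ v ∧ C = lineCone v m) ∨
      ∃ v : Fin n → Euc n, IsDefiniteForm w v ∧ C = genCone v) :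
    ComputesTo n C (solidAngle (C : Set (Euc n))) := by
  rcases hC with ⟨v, p, hv, rfl⟩ | ⟨v, hv, rfl⟩
  · obtain _ | m := n
    · exact p.elim0
    obtain ⟨φ, u, hu, hli, h⟩ := lineCone_eq_orthSumCone hv p
    rw [h, solidAngle_orthSumCone φ (measurableSet_of_fg (genCone_fg u))]
    exact ComputesTo.reduce (Nat.lt_succ_self m) φ _ _ (ih m (Nat.lt_succ_self m) u hu hli)
  · obtain ⟨hs, h⟩ := hv.summable_and_solidAngle_eq
    rw [h]
    exact ComputesTo.series v hv.norm_eq_one hv.linearIndependent hv.posDef hs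

theorem computesTo_solidAngle (n : ℕ) (w : Fin n → Euc n) (hw_norm : ∀ i, ‖w i‖ = 1)
    (hw : LinearIndependent ℝ w) :
    ComputesTo n (genCone w) (solidAngle (genCone w : Set (Euc n))) := by
  induction n using Nat.strong_induction_on with
  | _ n ih =>
  obtain ⟨N, s, C, hdec, hC⟩ := exists_firstDecomposition_lineCone hw_norm hw
  rw [hdec.solidAngle_eq]
  exact ComputesTo.decompose w hw_norm hw s C hdec _ fun i => computesTo_of_forms ih (hC i)

theorem corollary2p4 (n : ℕ) (w : Fin n → Euc n) (hw_norm : ∀ i, ‖w i‖ = 1)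
    (hw : LinearIndependent ℝ w) :
    -- There is a decomposition all of whose pieces are treated by the recursive procedure.
    (∃ (N : ℕ) (s : Fin N → ℤˣ) (C : Fin N → PointedCone ℝ (Euc n)),
      IsFirstDecomposition w s C ∧
        ∀ i, ComputesTo n (C i) (solidAngle (C i : Set (Euc n)))) ∧
    -- Every such decomposition computes the normalized solid angle.
    (∀ (N : ℕ) (s : Fin N → ℤˣ) (C : Fin N → PointedCone ℝ (Euc n)),
      IsFirstDecomposition w s C →
        solidAngle (genCone w : Set (Euc n)) =
            ∑ i, ((s i : ℤ) : ℝ) * solidAngle (C i : Set (Euc n)) ∧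
        -- pieces with positive definite matrix: the power series
        (∀ i, ∀ v : Fin n → Euc n, IsDefiniteForm w v → C i = genCone v →
          (Summable fun a : IndexPair n → ℕ => ‖seriesTerm v a‖) ∧
            solidAngle (C i : Set (Euc n)) = seriesValue v) ∧
        -- pieces that contain lines: reduction to lower dimension
        (∀ i, IsConeWithLine (C i) →
          (∃ m < n, ∃ (φ : Euc m →ₗᵢ[ℝ] Euc n) (C' : PointedCone ℝ (Euc m)),
            C'.FG ∧ C i = orthSumCone φ C') ∧
          (∀ (m : ℕ) (φ : Euc m →ₗᵢ[ℝ] Euc n) (C' : PointedCone ℝ (Euc m)),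
            C i = orthSumCone φ C' →
              solidAngle (C i : Set (Euc n)) = solidAngle (C' : Set (Euc m)))) ∧
        -- whatever value the procedure assigns to a piece, it is the solid angle
        (∀ i t, ComputesTo n (C i) t → t = solidAngle (C i : Set (Euc n)))) ∧
    -- The procedure applies to the cone itself, and its only possible value is the solid angle.
    (∀ t : ℝ, ComputesTo n (genCone w) t ↔ t = solidAngle (genCone w : Set (Euc n))) := by
  refine ⟨?_, fun N s C hdec => ⟨hdec.solidAngle_eq, fun i v hv hi => ?_, fun i hi => ?_,
    fun i t ht => ht.eq_solidAngle⟩, fun t => ⟨fun ht => ht.eq_solidAngle, ?_⟩⟩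
  · obtain ⟨N, s, C, hdec, hC⟩ := exists_firstDecomposition_lineCone hw_norm hw
    exact ⟨N, s, C, hdec, fun i => computesTo_of_forms
      (fun m _ u hu hli => computesTo_solidAngle m u hu hli) (hC i)⟩
  · rw [hi]
    exact hv.summable_and_solidAngle_eq
  · refine ⟨isConeWithLine_eq_orthSumCone hi, fun m φ C' h => ?_⟩
    -- `C'` is an arbitrary cone here, so its measurability is inherited from the piece.
    have hm := measurableSet_of_fg hi.1
    rw [h] at hm
    rw [h, solidAngle_orthSumCone φ (measurableSet_of_orthSumCone φ hm)]
  · rintro rfl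
    exact computesTo_solidAngle n w hw_norm hw
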